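/- Let $(\Omega,\mathfrak F,P)$ be a probability space and, for every $\Delta>0$, let $X_\Delta=(X_\Delta(t),\,t\in\mathbb R)$ be a measurable, stationary, centred, real-valued Gaussian process on it with a non-negative continuous spectral density $f_\Delta$, i.e. $K_\Delta(t)=\mathsf E X_\Delta(s+t)X_\Delta(s)=\int_{-\infty}^{\infty}e^{i\lambda t}f_\Delta(\lambda)\,d\lambda$ for all $s,t\in\mathbb R$. Assume that (a) $f_\Delta(\lambda)=f_\Delta(-\lambda)$ for all $\lambda\in\mathbb R$ and $\Delta>0$; (b) $\sup_{\Delta>0}\|f_\Delta\|_\infty<\infty$; (c) $f_\Delta\in L_1(\mathbb R)$ for all $\Delta>0$; (d) there is a constant $c\in(0,\infty)$ such that for all $a\in(0,\infty)$, $\lim_{\Delta\to\infty}\sup_{-a\le\lambda\le a}\left|f_\Delta(\lambda)-\frac{c}{2\pi}\right|=0$; (e) $K_\Delta\in L_1(\mathbb R)$ for all $\Delta>0$. Let $H\in L_2(\mathbb R)$ be real-valued, with Fourier–Plancherel transform $H^*(\lambda)=\int_{-\infty}^{\infty}e^{-i\lambda x}H(x)\,dx$ (the integral converging in $L_2(\mathbb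 R)$). For $T,\Delta>0$ and $t,\tau\in\mathbb R$ put $$Y_\Delta(t)=\int_{-\infty}^{\infty}H(s)X_\Delta(t-s)\,ds,\qquad H_{T,\Delta}(\tau)=\frac1{cT}\int_0^T Y_\Delta(t+\tau)X_\Delta(t)\,dt,$$ $$Z_{T,\Delta}(\tau)=\sqrt T\,\bigl[H_{T,\Delta}(\tau)-\mathsf E H_{T,\Delta}(\tau)\bigr],$$ where the first integral is the limit in mean square of $\int_a^b H(s)X_\Delta(t-s)\,ds$ as $a\to-\infty$, $b\to\infty$, and the second is a mean-square Riemann integral. Then these mean-square limits exist, and for all $\tau_1,\tau_2\in\mathbb R$ $$\lim_{T\to\infty,\ \Delta\to\infty}\mathsf E\,Z_{T,\Delta}(\tau_1)Z_{T,\Delta}(\tau_2)=C_\infty(\tau_1,\tau_2):=\frac1{2\pi}\int_{-\infty}^{\infty}\Bigl[e^{i(\tau_1-\tau_2)\lambda}|H^*(\lambda)|^2+e^{i(\tau_1+\tau_2)\lambda}(H^*(\lambda))^2\Bigr]d\lambda,$$ where $T$ and $\Delta$ tend to infinity simultaneously and in an arbitrary manner (a joint limit). -/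

import Mathlib

open MeasureTheory ProbabilityTheory Filter Topology Set
open scoped FourierTransform

noncomputable section

/-- `Y` is the limit in mean square (the limit in `L₂(Ω, P)`) of the random variables `u i`
along the filter `l`. -/
def IsMSLimit {Ω ι : Type*} [MeasurableSpace Ω] (P : Measure Ω) (l : Filter ι)
    (u : ι → Ω → ℝ) (Y : Ω → ℝ) : Prop :=
  MemLp Y 2 P ∧ Tendsto (fun i => eLpNorm (fun ω => u i ω - Y ω) 2 P) l (𝓝 0)

open Classical in
/-- The limit in mean square, a random variable determined up to a null set whenever the limit
exists and `l` is a proper filter (and `0` by convention if there is no limit). -/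
def msLimit {Ω ι : Type*} [MeasurableSpace Ω] (P : Measure Ω) (l : Filter ι)
    (u : ι → Ω → ℝ) : Ω → ℝ :=
  if h : ∃ Y, IsMSLimit P l u Y then h.choose else 0

/-- A tagged partition `a = pts 0 ≤ tag 0 ≤ pts 1 ≤ tag 1 ≤ ⋯ ≤ pts n = b` of `[a, b]`.
(The values of `pts` beyond `n` and of `tag` from `n` on play no role.) -/
structure TaggedPart (a b : ℝ) where
  n : ℕ
  pts : ℕ → ℝ
  tag : ℕ → ℝ
  pts_zero : pts 0 = a
  pts_last : pts n = b
  tag_mem : ∀ k < n, tag k ∈ Icc (pts k) (pts (k + 1))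

/-- The mesh of a tagged partition: the largest length of its intervals. -/
def TaggedPart.mesh {a b : ℝ} (π : TaggedPart a b) : ℝ :=
  ⨆ k : Fin π.n, (π.pts (k + 1) - π.pts k)

/-- The filter "the mesh of the tagged partition of `[a, b]` tends to `0`". -/
def TaggedPart.fine (a b : ℝ) : Filter (TaggedPart a b) :=
  comap TaggedPart.mesh (𝓝 0)

/-- The Riemann sum of the random process `ξ` for a tagged partition. -/
def riemannSum {Ω : Type*} {a b : ℝ} (ξ : ℝ → Ω → ℝ) (π : TaggedPart a b) (ω : Ω) : ℝ :=
  ∑ k ∈ Finset.range π.n, ξ (π.tag k) ω * (π.pts (k + 1) - π.pts k)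

/-- The mean-square Riemann integral `∫_a^b ξ(t) dt`. -/
def msRiemannIntegral {Ω : Type*} [MeasurableSpace Ω] (P : Measure Ω) (ξ : ℝ → Ω → ℝ)
    (a b : ℝ) : Ω → ℝ :=
  msLimit P (TaggedPart.fine a b) (riemannSum ξ)

/-- The family of inputs: for every `Δ > 0`, `X Δ` is a measurable centred stationary real Gaussian
process with spectral density `f Δ`, and the spectral densities approach the constant `c / 2π`.
Stationarity is contained in `spectral`: the covariance of `X Δ (s + t)` and `X Δ s` does not
depend on `s`. -/
structure IsInputFamily {Ω : Type*} [MeasurableSpace Ω] (P : Measure Ω)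
    (X : ℝ → ℝ → Ω → ℝ) (f : ℝ → ℝ → ℝ) (c : ℝ) : Prop where
  measurable : ∀ Δ > 0, Measurable (fun p : ℝ × Ω => X Δ p.1 p.2)
  gaussian : ∀ Δ > 0, IsGaussianProcess (X Δ) P
  centred : ∀ Δ > 0, ∀ t, ∫ ω, X Δ t ω ∂P = 0
  spectral : ∀ Δ > 0, ∀ s t : ℝ, ((∫ ω, X Δ (s + t) ω * X Δ s ω ∂P : ℝ) : ℂ) =
    ∫ l : ℝ, Complex.exp (Complex.I * l * t) * (f Δ l : ℂ)
  density_nonneg : ∀ Δ > 0, ∀ l, 0 ≤ f Δ l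
  density_continuous : ∀ Δ > 0, Continuous (f Δ)
  density_even : ∀ Δ > 0, ∀ l, f Δ (-l) = f Δ l
  density_bounded : ∃ M : ℝ, ∀ Δ > 0, ∀ l, f Δ l ≤ M
  density_integrable : ∀ Δ > 0, Integrable (f Δ)
  const_pos : 0 < c
  density_tendsto : ∀ a > 0,
    TendstoUniformlyOn f (fun _ => c / (2 * Real.pi)) atTop (Icc (-a) a)
  covariance_integrable : ∀ Δ > 0, Integrable (fun t : ℝ => ∫ ω, X Δ t ω * X Δ 0 ω ∂P)

/-- The integral `∫_a^b H(s) x(t - s) ds` along the paths of `x`, where `p = (a, b)`. -/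
def truncatedResponse {Ω : Type*} (H : ℝ → ℝ) (x : ℝ → Ω → ℝ) (t : ℝ) (p : ℝ × ℝ) (ω : Ω) : ℝ :=
  ∫ s in p.1..p.2, H s * x (t - s) ω

/-- The output `Y(t) = ∫_{-∞}^{∞} H(s) x(t - s) ds` of the linear system with impulse response
function `H` and input `x`; the improper integral is a limit in mean square. -/
def response {Ω : Type*} [MeasurableSpace Ω] (P : Measure Ω) (H : ℝ → ℝ) (x : ℝ → Ω → ℝ)
    (t : ℝ) : Ω → ℝ :=
  msLimit P (atBot ×ˢ atTop) (truncatedResponse H x t)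

/-- The process `t ↦ Y(t + τ) x(t)` that is averaged in the cross-correlogram. -/
def laggedProduct {Ω : Type*} [MeasurableSpace Ω] (P : Measure Ω) (H : ℝ → ℝ) (x : ℝ → Ω → ℝ)
    (τ t : ℝ) (ω : Ω) : ℝ :=
  response P H x (t + τ) ω * x t ω

/-- The cross-correlogram estimator `(1 / cT) ∫_0^T Y(t + τ) x(t) dt` of `H(τ)`. -/
def correlogram {Ω : Type*} [MeasurableSpace Ω] (P : Measure Ω) (c : ℝ) (H : ℝ → ℝ)
    (x : ℝ → Ω → ℝ) (T τ : ℝ) (ω : Ω) : ℝ :=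
  1 / (c * T) * msRiemannIntegral P (laggedProduct P H x τ) 0 T ω

/-- `Z(τ) = √T (Ĥ(τ) - E Ĥ(τ))`, with `Ĥ` the cross-correlogram estimator. -/
def centredError {Ω : Type*} [MeasurableSpace Ω] (P : Measure Ω) (c : ℝ) (H : ℝ → ℝ)
    (x : ℝ → Ω → ℝ) (T τ : ℝ) (ω : Ω) : ℝ :=
  Real.sqrt T * (correlogram P c H x T τ ω - ∫ ω', correlogram P c H x T τ ω' ∂P)

/-- The Fourier–Plancherel transform `H*(l) = ∫ exp(-i l x) H(x) dx` of a real `H ∈ L₂(ℝ)`.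
The kernel of `𝓕` is `exp(-2π i ν x)`, so that `H*(l) = (𝓕 H)(l / 2π)`. -/
def fourierPlancherel (H : ℝ → ℝ) (hH : MemLp H 2 (volume : Measure ℝ)) (l : ℝ) : ℂ :=
  (𝓕 (hH.ofReal (K := ℂ)).toLp : Lp ℂ 2 (volume : Measure ℝ)) (l / (2 * Real.pi))

/-- The limit covariance function `C_∞(τ₁, τ₂)`. -/
def limitCov (H : ℝ → ℝ) (hH : MemLp H 2 (volume : Measure ℝ)) (τ₁ τ₂ : ℝ) : ℂ :=
  1 / (2 * Real.pi) * ∫ l : ℝ,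
    (Complex.exp (Complex.I * (τ₁ - τ₂) * l) * (‖fourierPlancherel H hH l‖ : ℂ) ^ 2 +
      Complex.exp (Complex.I * (τ₁ + τ₂) * l) * fourierPlancherel H hH l ^ 2)

end

/-! ### The Fourier transform on `L¹ ∩ L²` -/

/-! Everything takes place in the Hilbert space `L²(Ω, P)`. In the frequency variable `ν = λ / 2π`
the input is a curve with Gram function `𝓕⁻ ρ (s - t)`, where `ρ ν = 2π f(2πν)` is bounded by a
constant independent of `Δ` and tends to `c` locally uniformly. Filtering with an integrable `h`
multiplies the density by `𝓕 h` (cross-covariance) or by `|𝓕 h|²` (auto-covariance). Since `ρ ≤ M`,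
Plancherel gives `‖h * x‖² ≤ M ‖h‖₂²`, so the outputs of truncated filters converge
(`IsSpectralCurve.exists_tendsto_curveConv`), and the covariance formulas pass to the limit with
`G`, the Plancherel transform of `H`.

The output lies in the closed span of the input. There the Gaussian identity `‖ξ‖₄ = 3^(1/4) ‖ξ‖₂`
persists (`HasGaussianMoments.topologicalClosure`). It makes products continuous as a map into `L²`,
so the mean-square Riemann integral exists. By polarization it also gives Isserlis' formula, which
turns the covariance in question into `1 / (c² T)` times the integral over `(0, T]²` of an
auto-covariance product plus a cross-covariance product.

The two products need different treatments. In the first, the input covariance does not converge in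
`L²` as the density flattens, but `|G|²` is integrable. On the frequency side a rescaled Fejér
kernel gives one dominating function for all `T` and `Δ` (`IsFlatteningFamily.tendsto_auto`). In the
second, both factors are inverse transforms of `ρ G`, which converges to `c G` in `L²`. On the time
side the square average is an `L²` pairing with a triangular weight bounded by `1` and tending to
`1`, and Parseval evaluates the limit (`IsFlatteningFamily.tendsto_cross`). Both arguments work
along the product filter, so no relation between the rates of `T` and `Δ` is needed. -/

theorem continuous_fourier {g : ℝ → ℂ} (hg : Integrable g) : Continuous (𝓕 g) :=
  VectorFourier.fourierIntegral_continuous Real.continuous_fourierChar continuous_inner hg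

theorem continuous_fourierInv {g : ℝ → ℂ} (hg : Integrable g) : Continuous (𝓕⁻ g) := by
  have : 𝓕⁻ g = fun w => 𝓕 g (-w) := funext fun w => Real.fourierInv_eq_fourier_neg g w
  rw [this]
  exact (continuous_fourier hg).comp continuous_neg

/-- Both sides are locally integrable, so testing against smooth compactly supported functions
suffices. The distributional definition moves the transform from `h` to the test function, and
Fubini moves it back as an integral. -/
theorem MeasureTheory.Lp.fourier_toLp_ae_eq {h : ℝ → ℂ} (h1 : Integrable h)
    (h2 : MemLp h 2 (volume : Measure ℝ)) :
    ((𝓕 h2.toLp : Lp ℂ 2 (volume : Measure ℝ)) : ℝ → ℂ) =ᵐ[volume] 𝓕 h := by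
  refine ae_eq_of_integral_contDiff_smul_eq ?_ (continuous_fourier h1).locallyIntegrable ?_
  · exact (Lp.memLp _).locallyIntegrable (by norm_num)
  · intro g hg hgc
    have hg' : ContDiff ℝ (⊤ : ℕ∞) (fun x => (g x : ℂ)) := Complex.ofRealCLM.contDiff.comp hg
    have hgc' : HasCompactSupport (fun x => (g x : ℂ)) := hgc.comp_left Complex.ofReal_zero
    let φ : SchwartzMap ℝ ℂ := hgc'.toSchwartzMap hg'
    have hφ : ∀ x, φ x = (g x : ℂ) := fun x => rfl
    have key := congrArg (fun u => u φ) (Lp.fourier_toTemperedDistribution_eq (h2.toLp))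
    simp only [TemperedDistribution.fourier_apply, Lp.toTemperedDistribution_apply] at key
    have e1 : ∫ x, g x • (𝓕 h2.toLp : Lp ℂ 2 (volume : Measure ℝ)) x =
        ∫ x, φ x • (𝓕 h2.toLp : Lp ℂ 2 (volume : Measure ℝ)) x := by
      simp [hφ]
    rw [e1, ← key]
    have e2 : ∫ x, (𝓕 φ) x • (h2.toLp : Lp ℂ 2 (volume : Measure ℝ)) x = ∫ x, (𝓕 φ) x • h x := by
      apply integral_congr_ae
      filter_upwards [h2.coeFn_toLp] with x hx
      rw [hx]
    rw [e2, SchwartzMap.fourier_coe]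
    have := VectorFourier.integral_fourierIntegral_smul_eq_flip (μ := (volume : Measure ℝ))
      (ν := (volume : Measure ℝ)) (L := innerₗ ℝ) (f := φ) (g := h)
      Real.continuous_fourierChar continuous_inner φ.integrable h1
    rw [flip_innerₗ] at this
    refine Eq.trans this ?_
    simp only [hφ, Complex.real_smul, smul_eq_mul]
    rfl

theorem MeasureTheory.Lp.fourierInv_toLp_ae_eq {h : ℝ → ℂ} (h1 : Integrable h)
    (h2 : MemLp h 2 (volume : Measure ℝ)) :
    ((𝓕⁻ h2.toLp : Lp ℂ 2 (volume : Measure ℝ)) : ℝ → ℂ) =ᵐ[volume] 𝓕⁻ h := by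
  refine ae_eq_of_integral_contDiff_smul_eq ?_ (continuous_fourierInv h1).locallyIntegrable ?_
  · exact (Lp.memLp _).locallyIntegrable (by norm_num)
  · intro g hg hgc
    have hg' : ContDiff ℝ (⊤ : ℕ∞) (fun x => (g x : ℂ)) := Complex.ofRealCLM.contDiff.comp hg
    have hgc' : HasCompactSupport (fun x => (g x : ℂ)) := hgc.comp_left Complex.ofReal_zero
    let φ : SchwartzMap ℝ ℂ := hgc'.toSchwartzMap hg'
    have hφ : ∀ x, φ x = (g x : ℂ) := fun x => rfl
    have key := congrArg (fun u => u φ) (Lp.fourierInv_toTemperedDistribution_eq (h2.toLp))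
    simp only [TemperedDistribution.fourierInv_apply, Lp.toTemperedDistribution_apply] at key
    have e1 : ∫ x, g x • (𝓕⁻ h2.toLp : Lp ℂ 2 (volume : Measure ℝ)) x =
        ∫ x, φ x • (𝓕⁻ h2.toLp : Lp ℂ 2 (volume : Measure ℝ)) x := by
      simp [hφ]
    rw [e1, ← key]
    have e2 : ∫ x, (𝓕⁻ φ) x • (h2.toLp : Lp ℂ 2 (volume : Measure ℝ)) x = ∫ x, (𝓕⁻ φ) x • h x := by
      apply integral_congr_ae
      filter_upwards [h2.coeFn_toLp] with x hx
      rw [hx]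
    rw [e2, SchwartzMap.fourierInv_coe]
    have := VectorFourier.integral_fourierIntegral_smul_eq_flip (μ := (volume : Measure ℝ))
      (ν := (volume : Measure ℝ)) (L := -innerₗ ℝ) (f := φ) (g := h)
      Real.continuous_fourierChar
      (by simp only [LinearMap.neg_apply, innerₗ_apply_apply]; fun_prop) φ.integrable h1
    -- The inverse transform is the Fourier integral for the negated pairing, which is again
    -- symmetric.
    have hf : (-innerₗ ℝ : ℝ →ₗ[ℝ] ℝ →ₗ[ℝ] ℝ).flip = -innerₗ ℝ := by
      ext; simp
    rw [hf] at this
    refine Eq.trans this ?_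
    simp only [hφ, Complex.real_smul, smul_eq_mul]
    rfl

/-! ### Convergence in `L²` -/

theorem tendsto_eLpNorm_two_of_dominated {α ι E : Type*} [MeasurableSpace α] {μ : Measure α}
    [NormedAddCommGroup E] {l : Filter ι} [l.IsCountablyGenerated] {F : ι → α → E} {f : α → E}
    {G : α → ℝ} (hF : ∀ᶠ i in l, AEStronglyMeasurable (F i) μ) (hf : AEStronglyMeasurable f μ)
    (hG : MemLp G 2 μ) (hb : ∀ᶠ i in l, ∀ᵐ x ∂μ, ‖F i x - f x‖ ≤ G x)
    (hlim : ∀ᵐ x ∂μ, Tendsto (fun i => F i x) l (𝓝 (f x))) :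
    Tendsto (fun i => eLpNorm (F i - f) 2 μ) l (𝓝 0) := by
  have hmem : ∀ᶠ i in l, MemLp (F i - f) 2 μ := by
    filter_upwards [hF, hb] with i h1 h2
    exact hG.mono' (h1.sub hf) h2
  have key : Tendsto (fun i => ∫ x, ‖F i x - f x‖ ^ (2 : ℝ) ∂μ) l (𝓝 (∫ _, 0 ∂μ)) := by
    refine tendsto_integral_filter_of_dominated_convergence (fun x => G x ^ 2) ?_ ?_
      hG.integrable_sq ?_
    · filter_upwards [hF] with i hi
      exact ((hi.sub hf).norm.aemeasurable.pow_const _).aestronglyMeasurable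
    · filter_upwards [hb] with i hi
      filter_upwards [hi] with x hx
      rw [Real.rpow_two, norm_pow, norm_norm]
      gcongr
    · filter_upwards [hlim] with x hx
      have h0 : Tendsto (fun i => ‖F i x - f x‖) l (𝓝 0) := by
        have := (hx.sub_const (f x)).norm
        simpa using this
      simpa using h0.pow 2
  have h2 := (key.rpow_const (p := (1 / 2 : ℝ)) (Or.inr (by norm_num)))
  simp only [integral_zero] at h2
  rw [Real.zero_rpow (by norm_num)] at h2
  have h3 := (ENNReal.continuous_ofReal.tendsto 0).comp h2
  rw [ENNReal.ofReal_zero] at h3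
  refine h3.congr' ?_
  filter_upwards [hmem] with i hi
  rw [hi.eLpNorm_eq_integral_rpow_norm (by norm_num) (by norm_num)]
  norm_num

theorem norm_integral_mul_conj_le {α : Type*} [MeasurableSpace α] {μ : Measure α}
    {C : ℝ} (hC : 0 ≤ C) {k : α → ℂ} (hk : ∀ x, ‖k x‖ ≤ C) (a b : Lp ℂ 2 μ) :
    ‖∫ x, k x * (a x * starRingEnd ℂ (b x)) ∂μ‖ ≤ C * (‖a‖ * ‖b‖) := by
  have hab : Integrable (fun x => ‖a x‖ * ‖b x‖) μ :=
    (Lp.memLp a).norm.integrable_mul (Lp.memLp b).norm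
  calc ‖∫ x, k x * (a x * starRingEnd ℂ (b x)) ∂μ‖ ≤ ∫ x, C * (‖a x‖ * ‖b x‖) ∂μ := by
        refine norm_integral_le_of_norm_le (hab.const_mul C) (Eventually.of_forall fun x => ?_)
        rw [norm_mul, norm_mul, RCLike.norm_conj]
        gcongr
        exact hk x
    _ = C * ∫ x, ‖a x‖ * ‖b x‖ ∂μ := integral_const_mul _ _
    _ ≤ C * (‖a‖ * ‖b‖) := by
        gcongr
        have h := integral_mul_norm_le_Lp_mul_Lq (p := 2) (q := 2) (by constructor <;> norm_num)
          (by simpa using Lp.memLp a) (by simpa using Lp.memLp b)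
        refine h.trans (le_of_eq ?_)
        congr 1 <;>
        · rw [Lp.norm_def, MemLp.eLpNorm_eq_integral_rpow_norm (by norm_num) (by norm_num)
            (Lp.memLp _), ENNReal.toReal_ofReal (by positivity)]
          norm_num

theorem integrable_mul_conj_coeFn {α : Type*} [MeasurableSpace α] {μ : Measure α}
    {C : ℝ} {k : α → ℂ} (hkm : AEStronglyMeasurable k μ) (hk : ∀ x, ‖k x‖ ≤ C) (a b : Lp ℂ 2 μ) :
    Integrable (fun x => k x * (a x * starRingEnd ℂ (b x))) μ :=
  (L2.integrable_inner (𝕜 := ℂ) b a).bdd_mul hkm (Eventually.of_forall hk)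

/-- The weighted pairing `∫ k a b̄` is continuous in `a, b ∈ L²`, uniformly in the bounded
weight. -/
theorem tendsto_integral_mul_conj_sub {α ι : Type*} [MeasurableSpace α] {μ : Measure α}
    {l : Filter ι} {C : ℝ} {k : ι → α → ℂ} (hkm : ∀ i, AEStronglyMeasurable (k i) μ)
    (hk : ∀ i x, ‖k i x‖ ≤ C) {a b : ι → Lp ℂ 2 μ} {a₀ b₀ : Lp ℂ 2 μ}
    (ha : Tendsto a l (𝓝 a₀)) (hb : Tendsto b l (𝓝 b₀)) :
    Tendsto (fun i => ∫ x, k i x * (a i x * starRingEnd ℂ (b i x)) ∂μ -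
      ∫ x, k i x * (a₀ x * starRingEnd ℂ (b₀ x)) ∂μ) l
      (𝓝 0) := by
  -- The sign of `C` is read off from one value of `k`, so the cases without any value are split off
  -- first.
  rcases isEmpty_or_nonempty α with hα | ⟨⟨x₀⟩⟩
  · have : μ = 0 := Measure.eq_zero_of_isEmpty μ
    simpa [this] using tendsto_const_nhds
  rcases isEmpty_or_nonempty ι with hι | ⟨⟨i₀⟩⟩
  · have : l = ⊥ := Subsingleton.elim _ _
    simp [this]
  have hC : 0 ≤ C := (norm_nonneg _).trans (hk i₀ x₀)
  have hlim : Tendsto (fun i => C * (‖a i - a₀‖ * ‖b i‖) + C * (‖a₀‖ * ‖b i - b₀‖)) l (𝓝 0) := by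
    have h1 : Tendsto (fun i => ‖a i - a₀‖) l (𝓝 0) := by
      simpa using (ha.sub_const a₀).norm
    have h2 : Tendsto (fun i => ‖b i - b₀‖) l (𝓝 0) := by
      simpa using (hb.sub_const b₀).norm
    simpa using ((h1.mul hb.norm).const_mul C).add ((h2.const_mul ‖a₀‖).const_mul C)
  refine squeeze_zero_norm (fun i => ?_) hlim
  have e : ∫ x, k i x * (a i x * starRingEnd ℂ (b i x)) ∂μ -
        ∫ x, k i x * (a₀ x * starRingEnd ℂ (b₀ x)) ∂μ =
      ∫ x, k i x * ((a i - a₀ : Lp ℂ 2 μ) x * starRingEnd ℂ (b i x)) ∂μ +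
        ∫ x, k i x * (a₀ x * starRingEnd ℂ ((b i - b₀ : Lp ℂ 2 μ) x)) ∂μ := by
    rw [← integral_sub (integrable_mul_conj_coeFn (hkm i) (hk i) _ _)
      (integrable_mul_conj_coeFn (hkm i) (hk i) _ _),
      ← integral_add (integrable_mul_conj_coeFn (hkm i) (hk i) _ _)
      (integrable_mul_conj_coeFn (hkm i) (hk i) _ _)]
    apply integral_congr_ae
    filter_upwards [Lp.coeFn_sub (a i) a₀, Lp.coeFn_sub (b i) b₀] with x h1 h2
    rw [h1, h2, Pi.sub_apply, Pi.sub_apply, map_sub]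
    ring
  rw [e]
  exact (norm_add_le _ _).trans (add_le_add (norm_integral_mul_conj_le hC (hk i) _ _)
    (norm_integral_mul_conj_le hC (hk i) _ _))

/-! ### Riemann sums of a continuous vector-valued function -/

theorem TaggedPart.pts_mono {a b : ℝ} (π : TaggedPart a b) {k : ℕ} (hk : k < π.n) :
    π.pts k ≤ π.pts (k + 1) :=
  (π.tag_mem k hk).1.trans (π.tag_mem k hk).2

theorem TaggedPart.pts_le_pts {a b : ℝ} (π : TaggedPart a b) {j k : ℕ} (hjk : j ≤ k)
    (hk : k ≤ π.n) : π.pts j ≤ π.pts k := by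
  induction k, hjk using Nat.le_induction with
  | base => exact le_rfl
  | succ k _ ih => exact (ih (by omega)).trans (π.pts_mono (by omega))

theorem TaggedPart.pts_mem {a b : ℝ} (π : TaggedPart a b) {k : ℕ} (hk : k ≤ π.n) :
    π.pts k ∈ Icc a b :=
  ⟨π.pts_zero.symm.trans_le (π.pts_le_pts (Nat.zero_le k) hk),
    (π.pts_le_pts hk le_rfl).trans_eq π.pts_last⟩

theorem TaggedPart.length_le_mesh {a b : ℝ} (π : TaggedPart a b) {k : ℕ} (hk : k < π.n) :
    π.pts (k + 1) - π.pts k ≤ π.mesh :=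
  le_ciSup (f := fun k : Fin π.n => π.pts (k + 1) - π.pts k) (Set.finite_range _).bddAbove ⟨k, hk⟩

theorem TaggedPart.tendsto_sum_smul {E : Type*} [NormedAddCommGroup E] [NormedSpace ℝ E]
    [CompleteSpace E] {a b : ℝ} (hab : a ≤ b) {φ : ℝ → E} (hφ : Continuous φ) :
    Tendsto (fun π : TaggedPart a b =>
      ∑ k ∈ Finset.range π.n, (π.pts (k + 1) - π.pts k) • φ (π.tag k)) (TaggedPart.fine a b)
      (𝓝 (∫ t in a..b, φ t)) := by
  have huc : UniformContinuousOn φ (Icc a b) :=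
    isCompact_Icc.uniformContinuousOn_of_continuous hφ.continuousOn
  rw [Metric.tendsto_nhds]
  intro ε hε
  -- The `+ 1` keeps the divisor positive when `a = b` and makes the final inequality strict.
  obtain ⟨δ, hδ, h⟩ := Metric.uniformContinuousOn_iff_le.1 huc (ε / (b - a + 1))
    (div_pos hε (by linarith))
  have hmesh : ∀ᶠ π : TaggedPart a b in TaggedPart.fine a b, π.mesh < δ :=
    (tendsto_comap (f := TaggedPart.mesh)).eventually (gt_mem_nhds hδ)
  filter_upwards [hmesh] with π hπ
  have hint : ∀ c d : ℝ, IntervalIntegrable φ volume c d := fun c d => hφ.intervalIntegrable c d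
  have e : ∫ t in a..b, φ t = ∑ k ∈ Finset.range π.n, ∫ t in π.pts k..π.pts (k + 1), φ t := by
    rw [intervalIntegral.sum_integral_adjacent_intervals fun k _ => hint _ _, π.pts_zero,
      π.pts_last]
  rw [dist_eq_norm, e, ← Finset.sum_sub_distrib]
  calc ‖∑ k ∈ Finset.range π.n, ((π.pts (k + 1) - π.pts k) • φ (π.tag k) -
          ∫ t in π.pts k..π.pts (k + 1), φ t)‖
      ≤ ∑ k ∈ Finset.range π.n, ε / (b - a + 1) * (π.pts (k + 1) - π.pts k) := by
        refine norm_sum_le_of_le _ fun k hk => ?_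
        have hk' := Finset.mem_range.1 hk
        have hle := π.pts_mono hk'
        rw [← intervalIntegral.integral_const, ← intervalIntegral.integral_sub (by simp) (hint _ _)]
        refine (intervalIntegral.norm_integral_le_of_norm_le_const
          (C := ε / (b - a + 1)) fun t ht => ?_).trans ?_
        · rw [uIoc_of_le hle] at ht
          have htag := π.tag_mem k hk'
          have hl := π.length_le_mesh hk'
          have m1 := π.pts_mem hk'.le
          have m2 := π.pts_mem (Nat.succ_le_of_lt hk')
          rw [← dist_eq_norm]
          refine h _ ⟨m1.1.trans htag.1, htag.2.trans m2.2⟩ _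
            ⟨m1.1.trans ht.1.le, ht.2.trans m2.2⟩ ?_
          rw [Real.dist_eq, abs_le]
          constructor <;> linarith [htag.1, htag.2, ht.1, ht.2]
        · rw [abs_of_nonneg (by linarith)]
    _ = ε / (b - a + 1) * (b - a) := by
        rw [← Finset.mul_sum, Finset.sum_range_sub, π.pts_zero, π.pts_last]
    _ < ε := by
        rw [div_mul_eq_mul_div, div_lt_iff₀ (by linarith)]
        nlinarith

/-- The tagged partition of `[a, b]` into `n + 1` intervals of equal length. -/
noncomputable def TaggedPart.uniform {a b : ℝ} (hab : a ≤ b) (n : ℕ) : TaggedPart a b where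
  n := n + 1
  pts k := a + k * ((b - a) / (n + 1))
  tag k := a + k * ((b - a) / (n + 1))
  pts_zero := by simp
  pts_last := by
    push_cast
    field_simp
    ring
  tag_mem k _ := by
    have : 0 ≤ (b - a) / ((n : ℝ) + 1) := div_nonneg (by linarith) (by positivity)
    push_cast
    exact ⟨le_rfl, by nlinarith⟩

/-- Uniqueness of the mean-square Riemann integral depends on this: along a trivial filter
everything would be a limit. The uniform partitions have mesh tending to `0`. -/
theorem TaggedPart.fine_neBot {a b : ℝ} (hab : a ≤ b) : (TaggedPart.fine a b).NeBot := by
  have hm : ∀ n : ℕ, (TaggedPart.uniform hab n).mesh = (b - a) / (n + 1) := by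
    intro n
    have : ∀ k : Fin (n + 1), a + ((k : ℕ) + 1 : ℕ) * ((b - a) / ((n : ℝ) + 1)) -
        (a + (k : ℕ) * ((b - a) / ((n : ℝ) + 1))) = (b - a) / (n + 1) := by
      intro k
      push_cast
      ring
    change ⨆ k : Fin (n + 1), (a + ((k : ℕ) + 1 : ℕ) * ((b - a) / ((n : ℝ) + 1)) -
        (a + (k : ℕ) * ((b - a) / ((n : ℝ) + 1)))) = _
    simp_rw [this]
    exact ciSup_const
  have hlim : Tendsto (fun n : ℕ => TaggedPart.uniform hab n) atTop (TaggedPart.fine a b) := by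
    refine tendsto_comap_iff.2 ?_
    have : Tendsto (fun n : ℕ => (b - a) * (1 / ((n : ℝ) + 1))) atTop (𝓝 ((b - a) * 0)) :=
      tendsto_one_div_add_atTop_nhds_zero_nat.const_mul _
    rw [mul_zero] at this
    refine this.congr fun n => ?_
    rw [Function.comp_apply, hm]
    ring
  exact hlim.neBot

/-! ### Mean-square limits -/

theorem IsMSLimit.isMSLimit_msLimit {Ω ι : Type*} [MeasurableSpace Ω] {P : Measure Ω}
    {l : Filter ι} {u : ι → Ω → ℝ} {Y : Ω → ℝ} (h : IsMSLimit P l u Y) :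
    IsMSLimit P l u (msLimit P l u) := by
  have hex : ∃ Y, IsMSLimit P l u Y := ⟨Y, h⟩
  rw [msLimit, dif_pos hex]
  exact hex.choose_spec

/-- This makes the choice inside `msLimit` harmless: the chosen variable can be exchanged for an
explicit element of `Lp ℝ 2 P`. -/
theorem IsMSLimit.ae_eq {Ω ι : Type*} [MeasurableSpace Ω] {P : Measure Ω} {l : Filter ι}
    [l.NeBot] {u : ι → Ω → ℝ} (hu : ∀ᶠ i in l, AEStronglyMeasurable (u i) P) {Y Z : Ω → ℝ}
    (hY : IsMSLimit P l u Y) (hZ : IsMSLimit P l u Z) : Y =ᵐ[P] Z := by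
  have hle : ∀ᶠ i in l, eLpNorm (Y - Z) 2 P ≤
      eLpNorm (fun ω => u i ω - Y ω) 2 P + eLpNorm (fun ω => u i ω - Z ω) 2 P := by
    filter_upwards [hu] with i hi
    have e : Y - Z = (fun ω => u i ω - Z ω) - fun ω => u i ω - Y ω := by
      ext ω
      simp
    rw [e, add_comm]
    exact eLpNorm_sub_le (hi.sub hZ.1.1) (hi.sub hY.1.1) (by norm_num)
  have h0 : eLpNorm (Y - Z) 2 P ≤ 0 :=
    ge_of_tendsto (by simpa using hY.2.add hZ.2) hle
  have := (eLpNorm_eq_zero_iff (hY.1.1.sub hZ.1.1) (by norm_num)).1 (le_antisymm h0 bot_le)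
  filter_upwards [this] with ω hω
  exact sub_eq_zero.1 hω

/-- Convergence in the Banach space `Lp ℝ 2 P` is convergence in mean square. -/
theorem isMSLimit_of_tendsto_Lp {Ω ι : Type*} [MeasurableSpace Ω] {P : Measure Ω} {l : Filter ι}
    {u : ι → Ω → ℝ} {U : ι → Lp ℝ 2 P} {Y : Lp ℝ 2 P} (hu : ∀ᶠ i in l, u i =ᵐ[P] U i)
    (hU : Tendsto U l (𝓝 Y)) : IsMSLimit P l u Y := by
  refine ⟨Lp.memLp Y, ?_⟩
  refine ((Lp.tendsto_Lp_iff_tendsto_eLpNorm' U Y).1 hU).congr' ?_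
  filter_upwards [hu] with i hi
  apply eLpNorm_congr_ae
  filter_upwards [hi] with ω hω
  simp [hω]

/-! ### Fourth moments of Gaussian variables -/

/-- The fourth moment is the fourth derivative at `0` of the moment generating function `exp(v t² /
2)`. -/
theorem integral_pow_four_gaussianReal (v : NNReal) :
    ∫ x, x ^ 4 ∂(gaussianReal 0 v) = 3 * (v : ℝ) ^ 2 := by
  have h0 : (0 : ℝ) ∈ interior (integrableExpSet id (gaussianReal 0 v)) := by
    rw [integrableExpSet_id_gaussianReal]
    simp
  have h := iteratedDeriv_mgf_zero h0 4
  -- Differentiation acts on the polynomial factor by `p ↦ p' + v t p`. Starting from `1` this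
  -- yields `v t`, `v + v² t²`, `3 v² t + v³ t³`, and then a polynomial with constant term `3 v²`.
  have e : ∀ p : ℝ → ℝ, ∀ p' : ℝ → ℝ, (∀ t, HasDerivAt p (p' t) t) →
      deriv (fun t : ℝ => p t * Real.exp ((v : ℝ) * t ^ 2 / 2)) =
        fun t : ℝ => (p' t + p t * (v * t)) * Real.exp ((v : ℝ) * t ^ 2 / 2) := by
    intro p p' hp
    funext t
    have h1 : HasDerivAt (fun t : ℝ => (v : ℝ) * t ^ 2 / 2) (v * t) t := by
      have := ((hasDerivAt_pow 2 t).const_mul (v : ℝ)).div_const 2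
      convert! this using 1
      norm_num
      ring
    refine ((hp t).mul h1.exp).deriv.trans ?_
    ring
  have hm : mgf id (gaussianReal 0 v) = fun t => 1 * Real.exp ((v : ℝ) * t ^ 2 / 2) := by
    rw [mgf_id_gaussianReal]
    funext t
    simp
  have d1 : ∀ t : ℝ, HasDerivAt (fun t : ℝ => (v : ℝ) * t) v t := fun t => by
    simpa using (hasDerivAt_id t).const_mul (v : ℝ)
  have d2 : ∀ t : ℝ, HasDerivAt (fun t : ℝ => (v : ℝ) + v ^ 2 * t ^ 2) (2 * v ^ 2 * t) t :=
    fun t => by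
      have := ((hasDerivAt_pow 2 t).const_mul ((v : ℝ) ^ 2)).const_add (v : ℝ)
      convert! this using 1
      norm_num
      ring
  have d3 : ∀ t : ℝ, HasDerivAt (fun t : ℝ => 3 * (v : ℝ) ^ 2 * t + v ^ 3 * t ^ 3)
      (3 * v ^ 2 + 3 * v ^ 3 * t ^ 2) t := fun t => by
    have := ((hasDerivAt_id t).const_mul (3 * (v : ℝ) ^ 2)).add
      ((hasDerivAt_pow 3 t).const_mul ((v : ℝ) ^ 3))
    convert! this using 1
    norm_num
    ring
  rw [hm] at h
  simp only [iteratedDeriv_succ, iteratedDeriv_zero] at h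
  rw [e (fun _ => 1) (fun _ => 0) (fun t => hasDerivAt_const t 1)] at h
  simp only [zero_add, one_mul] at h
  rw [e _ _ d1] at h
  have q2 : ∀ t : ℝ, (v : ℝ) + v * t * (v * t) = v + v ^ 2 * t ^ 2 := fun t => by ring
  simp only [q2] at h
  rw [e _ _ d2] at h
  have q3 : ∀ t : ℝ, 2 * (v : ℝ) ^ 2 * t + (v + v ^ 2 * t ^ 2) * (v * t) =
      3 * v ^ 2 * t + v ^ 3 * t ^ 3 := fun t => by ring
  simp only [q3] at h
  rw [e _ _ d3] at h
  simpa using h.symm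

theorem ProbabilityTheory.HasGaussianLaw.integral_pow_four {Ω : Type*} [MeasurableSpace Ω]
    {P : Measure Ω} {ξ : Ω → ℝ} (h : HasGaussianLaw ξ P) (h0 : ∫ ω, ξ ω ∂P = 0) :
    ∫ ω, ξ ω ^ 4 ∂P = 3 * (∫ ω, ξ ω ^ 2 ∂P) ^ 2 := by
  have hm := h.map_eq_gaussianReal
  rw [h0] at hm
  have h4 : ∫ ω, ξ ω ^ 4 ∂P = ∫ x, x ^ 4 ∂(P.map ξ) :=
    (integral_map h.aemeasurable (continuous_pow 4).aestronglyMeasurable).symm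
  rw [h4, hm, integral_pow_four_gaussianReal, Real.coe_toNNReal _ (variance_nonneg _ _),
    variance_of_integral_eq_zero h.aemeasurable h0]

/-- A space of square-integrable random variables whose second and fourth moments are related as
those of centred Gaussian variables are. -/
def HasGaussianMoments {Ω : Type*} [MeasurableSpace Ω] {P : Measure Ω}
    (V : Submodule ℝ (Lp ℝ 2 P)) : Prop :=
  ∀ ξ ∈ V, eLpNorm ξ 4 P = ENNReal.ofReal (3 ^ (1 / 4 : ℝ)) * eLpNorm ξ 2 P

section GaussianMoments

variable {Ω : Type*} [MeasurableSpace Ω] {P : Measure Ω}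

theorem eLpNorm_four_eq_of_integral_pow_four {ξ : Ω → ℝ} (h2 : MemLp ξ 2 P) (h4 : MemLp ξ 4 P)
    (h : ∫ ω, ξ ω ^ 4 ∂P = 3 * (∫ ω, ξ ω ^ 2 ∂P) ^ 2) :
    eLpNorm ξ 4 P = ENNReal.ofReal (3 ^ (1 / 4 : ℝ)) * eLpNorm ξ 2 P := by
  rw [h2.eLpNorm_eq_integral_rpow_norm (by norm_num) (by norm_num),
    h4.eLpNorm_eq_integral_rpow_norm (by norm_num) (by norm_num),
    ← ENNReal.ofReal_mul (by positivity)]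
  congr 1
  have e2 : ∀ ω, ‖ξ ω‖ ^ (ENNReal.toReal 2) = ξ ω ^ 2 := fun ω => by simp
  have e4 : ∀ ω, ‖ξ ω‖ ^ (ENNReal.toReal 4) = ξ ω ^ 4 := fun ω => by
    simp only [ENNReal.toReal_ofNat, Real.rpow_ofNat, Real.norm_eq_abs]
    exact Even.pow_abs (by decide) _
  have hn : 0 ≤ ∫ ω, ξ ω ^ 2 ∂P := integral_nonneg fun ω => sq_nonneg _
  simp only [e2, e4, h]
  rw [Real.mul_rpow (by norm_num) (by positivity), ← Real.rpow_natCast, ← Real.rpow_mul hn]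
  norm_num

theorem HasGaussianMoments.memLp_four {V : Submodule ℝ (Lp ℝ 2 P)} (hV : HasGaussianMoments V)
    {ξ : Lp ℝ 2 P} (hξ : ξ ∈ V) : MemLp ξ 4 P := by
  refine ⟨Lp.aestronglyMeasurable ξ, ?_⟩
  rw [hV ξ hξ]
  exact ENNReal.mul_lt_top ENNReal.ofReal_lt_top (Lp.memLp ξ).2

theorem HasGaussianMoments.integral_pow_four {V : Submodule ℝ (Lp ℝ 2 P)}
    (hV : HasGaussianMoments V) {ξ : Lp ℝ 2 P} (hξ : ξ ∈ V) :
    ∫ ω, ξ ω ^ 4 ∂P = 3 * inner ℝ ξ ξ ^ 2 := by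
  have h := hV ξ hξ
  rw [(Lp.memLp ξ).eLpNorm_eq_integral_rpow_norm (by norm_num) (by norm_num),
    (hV.memLp_four hξ).eLpNorm_eq_integral_rpow_norm (by norm_num) (by norm_num),
    ← ENNReal.ofReal_mul (by positivity),
    ENNReal.ofReal_eq_ofReal_iff (by positivity) (by positivity)] at h
  have e2 : ∀ ω, ‖ξ ω‖ ^ (ENNReal.toReal 2) = ξ ω ^ 2 := fun ω => by simp
  have e4 : ∀ ω, ‖ξ ω‖ ^ (ENNReal.toReal 4) = ξ ω ^ 4 := fun ω => by
    simp only [ENNReal.toReal_ofNat, Real.rpow_ofNat, Real.norm_eq_abs]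
    exact Even.pow_abs (by decide) _
  have hi : inner ℝ ξ ξ = ∫ ω, ξ ω ^ 2 ∂P := by
    rw [L2.inner_def]
    simp [pow_two]
  simp only [e2, e4, ← hi] at h
  have hn : 0 ≤ inner ℝ ξ ξ := real_inner_self_nonneg
  have hn4 : 0 ≤ ∫ ω, ξ ω ^ 4 ∂P := integral_nonneg fun ω => by positivity
  have h4 : ∀ y : ℝ, 0 ≤ y → (y ^ (1 / 4 : ℝ)) ^ 4 = y := fun y hy => by
    rw [← Real.rpow_natCast, ← Real.rpow_mul hy]
    norm_num
  have h2 : (inner ℝ ξ ξ ^ (1 / 2 : ℝ)) ^ 4 = inner ℝ ξ ξ ^ 2 := by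
    rw [← Real.rpow_natCast, ← Real.rpow_mul hn, ← Real.rpow_natCast]
    norm_num
  rw [ENNReal.toReal_ofNat, ENNReal.toReal_ofNat, ← one_div, ← one_div] at h
  rw [← h4 _ hn4, h, mul_pow, h2, h4 3 (by norm_num)]

/-- Fatou along an almost surely convergent subsequence gives `≤` on the closure. Applied to `u n -
ξ`, which is also in the closure, this upgrades `L²` convergence to `L⁴` convergence, whence `≥`.
Stating the identity with `eLpNorm` allows `ξ` to be treated before its fourth moment is known to be
finite. -/
theorem HasGaussianMoments.topologicalClosure [IsProbabilityMeasure P]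
    {V : Submodule ℝ (Lp ℝ 2 P)} (hV : HasGaussianMoments V) :
    HasGaussianMoments V.topologicalClosure := by
  set κ := ENNReal.ofReal (3 ^ (1 / 4 : ℝ)) with hκ
  have hκt : κ ≠ ⊤ := ENNReal.ofReal_ne_top
  have seq : ∀ ξ ∈ V.topologicalClosure, ∃ u : ℕ → Lp ℝ 2 P, (∀ n, u n ∈ V) ∧
      Tendsto u atTop (𝓝 ξ) := fun ξ hξ => mem_closure_iff_seq_limit.1 hξ
  have tn : ∀ (u : ℕ → Lp ℝ 2 P) (ξ : Lp ℝ 2 P), Tendsto u atTop (𝓝 ξ) →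
      Tendsto (fun n => eLpNorm (u n) 2 P) atTop (𝓝 (eLpNorm ξ 2 P)) := by
    intro u ξ hu
    have := (continuous_enorm.tendsto ξ).comp hu
    simpa [Function.comp_def, Lp.enorm_def] using this
  have le : ∀ ξ ∈ V.topologicalClosure, eLpNorm ξ 4 P ≤ κ * eLpNorm ξ 2 P := by
    intro ξ hξ
    obtain ⟨u, huV, hu⟩ := seq ξ hξ
    obtain ⟨ns, hns, hae⟩ := (tendstoInMeasure_of_tendsto_Lp hu).exists_seq_tendsto_ae
    have hF := Lp.eLpNorm_lim_le_liminf_eLpNorm (p := 4)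
      (fun n => Lp.aestronglyMeasurable (u (ns n))) ξ hae
    refine hF.trans (le_of_eq ?_)
    have : Tendsto (fun n => eLpNorm (u (ns n)) 4 P) atTop (𝓝 (κ * eLpNorm ξ 2 P)) := by
      have := ENNReal.Tendsto.const_mul ((tn u ξ hu).comp hns.tendsto_atTop) (Or.inr hκt)
      refine this.congr fun n => ?_
      rw [hV _ (huV (ns n))]
      rfl
    exact this.liminf_eq
  intro ξ hξ
  refine _root_.le_antisymm (le ξ hξ) ?_
  obtain ⟨u, huV, hu⟩ := seq ξ hξ
  have h1 : Tendsto (fun n => κ * eLpNorm (u n) 2 P) atTop (𝓝 (κ * eLpNorm ξ 2 P)) :=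
    ENNReal.Tendsto.const_mul (tn u ξ hu) (Or.inr hκt)
  have h2 : Tendsto (fun n => eLpNorm ξ 4 P + κ * eLpNorm ((u n - ξ : Lp ℝ 2 P)) 2 P) atTop
      (𝓝 (eLpNorm ξ 4 P + κ * 0)) := by
    refine Tendsto.add tendsto_const_nhds (ENNReal.Tendsto.const_mul ?_ (Or.inr hκt))
    have := tn (fun n => u n - ξ) 0 (by simpa using hu.sub_const ξ)
    rwa [eLpNorm_congr_ae (Lp.coeFn_zero ℝ 2 P), eLpNorm_zero] at this
  rw [mul_zero, add_zero] at h2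
  refine le_of_tendsto_of_tendsto' h1 h2 fun n => ?_
  rw [← hV _ (huV n)]
  have hmem : u n - ξ ∈ V.topologicalClosure :=
    sub_mem (V.le_topologicalClosure (huV n)) hξ
  have e : (u n : Ω → ℝ) =ᵐ[P] (ξ : Ω → ℝ) + ((u n - ξ : Lp ℝ 2 P) : Ω → ℝ) := by
    filter_upwards [Lp.coeFn_sub (u n) ξ] with ω hω
    rw [Pi.add_apply, hω, Pi.sub_apply]
    ring
  rw [eLpNorm_congr_ae e]
  exact (eLpNorm_add_le (Lp.aestronglyMeasurable _) (Lp.aestronglyMeasurable _)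
    (by norm_num)).trans (by gcongr; exact le _ hmem)

/-- Polarization: the weight `i j k` keeps only monomials of odd degree in each of `b`, `c`, `d`. In
degree four only `a b c d` remains, with coefficient `24` in each of the `8` terms. -/
theorem mul_mul_mul_eq_sum_signs (a b c d : ℝ) :
    192 * (a * b * c * d) = ∑ i ∈ ({1, -1} : Finset ℝ), ∑ j ∈ ({1, -1} : Finset ℝ),
      ∑ k ∈ ({1, -1} : Finset ℝ), i * j * k * (a + i * b + j * c + k * d) ^ 4 := by
  simp only [Finset.sum_pair (show (1 : ℝ) ≠ -1 by norm_num)]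
  ring

/-- Isserlis' formula for the fourth mixed moments. -/
theorem HasGaussianMoments.integral_mul_mul_mul {V : Submodule ℝ (Lp ℝ 2 P)}
    (hV : HasGaussianMoments V) {a b c d : Lp ℝ 2 P} (ha : a ∈ V) (hb : b ∈ V) (hc : c ∈ V)
    (hd : d ∈ V) :
    ∫ ω, a ω * b ω * c ω * d ω ∂P =
      inner ℝ a b * inner ℝ c d + inner ℝ a c * inner ℝ b d + inner ℝ a d * inner ℝ b c := by
  have hmem : ∀ i j k : ℝ, a + i • b + j • c + k • d ∈ V := fun i j k =>
    add_mem (add_mem (add_mem ha (V.smul_mem _ hb)) (V.smul_mem _ hc)) (V.smul_mem _ hd)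
  have hae : ∀ i j k : ℝ, (fun ω => (a + i • b + j • c + k • d : Lp ℝ 2 P) ω ^ 4) =ᵐ[P]
      fun ω => (a ω + i * b ω + j * c ω + k * d ω) ^ 4 := by
    intro i j k
    filter_upwards [Lp.coeFn_add (a + i • b + j • c) (k • d), Lp.coeFn_add (a + i • b) (j • c),
      Lp.coeFn_add a (i • b), Lp.coeFn_smul i b, Lp.coeFn_smul j c, Lp.coeFn_smul k d]
      with ω h1 h2 h3 h4 h5 h6
    rw [h1, Pi.add_apply, h2, Pi.add_apply, h3, Pi.add_apply, h4, h5, h6]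
    simp
  have hint : ∀ i j k : ℝ, Integrable (fun ω => (a ω + i * b ω + j * c ω + k * d ω) ^ 4) P := by
    intro i j k
    have := (hV.memLp_four (hmem i j k)).integrable_norm_pow (p := 4) (by norm_num)
    refine this.congr ?_
    filter_upwards [hae i j k] with ω hω
    rw [← hω]
    exact Even.pow_abs (by decide) _
  have hval : ∀ i j k : ℝ, ∫ ω, (a ω + i * b ω + j * c ω + k * d ω) ^ 4 ∂P =
      3 * (inner ℝ a a + i ^ 2 * inner ℝ b b + j ^ 2 * inner ℝ c c + k ^ 2 * inner ℝ d d +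
        2 * (i * inner ℝ a b + j * inner ℝ a c + k * inner ℝ a d + i * j * inner ℝ b c +
          i * k * inner ℝ b d + j * k * inner ℝ c d)) ^ 2 := by
    intro i j k
    rw [← integral_congr_ae (hae i j k), hV.integral_pow_four (hmem i j k)]
    congr 2
    simp only [inner_add_left, inner_add_right, real_inner_smul_left, real_inner_smul_right]
    rw [real_inner_comm a b, real_inner_comm a c, real_inner_comm a d, real_inner_comm b c,
      real_inner_comm b d, real_inner_comm c d]
    ring
  have key : 192 * ∫ ω, a ω * b ω * c ω * d ω ∂P =
      ∑ i ∈ ({1, -1} : Finset ℝ), ∑ j ∈ ({1, -1} : Finset ℝ), ∑ k ∈ ({1, -1} : Finset ℝ),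
        i * j * k * ∫ ω, (a ω + i * b ω + j * c ω + k * d ω) ^ 4 ∂P := by
    rw [← integral_const_mul]
    simp only [mul_mul_mul_eq_sum_signs]
    have hk : ∀ i j k : ℝ, Integrable
        (fun ω => i * j * k * (a ω + i * b ω + j * c ω + k * d ω) ^ 4) P :=
      fun i j k => (hint i j k).const_mul _
    rw [integral_finsetSum _ fun i _ => integrable_finsetSum _ fun j _ =>
      integrable_finsetSum _ fun k _ => hk i j k]
    refine Finset.sum_congr rfl fun i _ => ?_
    rw [integral_finsetSum _ fun j _ => integrable_finsetSum _ fun k _ => hk i j k]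
    refine Finset.sum_congr rfl fun j _ => ?_
    rw [integral_finsetSum _ fun k _ => hk i j k]
    exact Finset.sum_congr rfl fun k _ => integral_const_mul _ _
  simp only [hval, Finset.sum_pair (show (1 : ℝ) ≠ -1 by norm_num)] at key
  linear_combination key / 192

/-- Hölder with `1/4 + 1/4 = 1/2`, after which each `L⁴` norm is replaced by a multiple of the `L²`
norm. Multiplication is thus bounded bilinear from `V × V` to `L²`. -/
theorem HasGaussianMoments.eLpNorm_mul_le {V : Submodule ℝ (Lp ℝ 2 P)}
    (hV : HasGaussianMoments V) {a b : Lp ℝ 2 P} (ha : a ∈ V) (hb : b ∈ V) :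
    eLpNorm (fun ω => a ω * b ω) 2 P ≤
      ENNReal.ofReal (3 ^ (1 / 4 : ℝ)) * eLpNorm a 2 P *
        (ENNReal.ofReal (3 ^ (1 / 4 : ℝ)) * eLpNorm b 2 P) := by
  have : ENNReal.HolderTriple 4 4 2 := ⟨by
    have h4 : (4 : ENNReal)⁻¹ = 2⁻¹ * 2⁻¹ := by
      rw [← ENNReal.mul_inv (by norm_num) (by norm_num)]
      norm_num
    rw [h4, ← mul_add, ENNReal.inv_two_add_inv_two, mul_one]⟩
  rw [← hV a ha, ← hV b hb]
  have h := eLpNorm_smul_le_mul_eLpNorm (p := 4) (q := 4) (r := 2)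
    (Lp.aestronglyMeasurable b) (Lp.aestronglyMeasurable a)
  exact h

theorem HasGaussianMoments.memLp_mul {V : Submodule ℝ (Lp ℝ 2 P)}
    (hV : HasGaussianMoments V) {a b : Lp ℝ 2 P} (ha : a ∈ V) (hb : b ∈ V) :
    MemLp (fun ω => a ω * b ω) 2 P :=
  ⟨(Lp.aestronglyMeasurable a).mul (Lp.aestronglyMeasurable b),
    (hV.eLpNorm_mul_le ha hb).trans_lt (ENNReal.mul_lt_top
      (ENNReal.mul_lt_top ENNReal.ofReal_lt_top (Lp.memLp a).2)
      (ENNReal.mul_lt_top ENNReal.ofReal_lt_top (Lp.memLp b).2))⟩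

theorem HasGaussianMoments.norm_toLp_mul_le {V : Submodule ℝ (Lp ℝ 2 P)}
    (hV : HasGaussianMoments V) {a b : Lp ℝ 2 P} (ha : a ∈ V) (hb : b ∈ V) :
    ‖(hV.memLp_mul ha hb).toLp‖ ≤ 3 ^ (1 / 4 : ℝ) * ‖a‖ * (3 ^ (1 / 4 : ℝ) * ‖b‖) := by
  rw [Lp.norm_toLp, Lp.norm_def, Lp.norm_def]
  have h := hV.eLpNorm_mul_le ha hb
  have ht := ENNReal.toReal_mono ?_ h
  · rwa [ENNReal.toReal_mul, ENNReal.toReal_mul, ENNReal.toReal_mul,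
      ENNReal.toReal_ofReal (by positivity)] at ht
  · exact ENNReal.mul_ne_top (ENNReal.mul_ne_top ENNReal.ofReal_ne_top (Lp.memLp a).2.ne)
      (ENNReal.mul_ne_top ENNReal.ofReal_ne_top (Lp.memLp b).2.ne)

theorem HasGaussianMoments.continuous_toLp_mul {V : Submodule ℝ (Lp ℝ 2 P)}
    (hV : HasGaussianMoments V) {T : Type*} [TopologicalSpace T] {u v : T → Lp ℝ 2 P}
    (hu : Continuous u) (hv : Continuous v) (huV : ∀ t, u t ∈ V) (hvV : ∀ t, v t ∈ V) :
    Continuous fun t => (hV.memLp_mul (huV t) (hvV t)).toLp := by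
  rw [continuous_iff_continuousAt]
  intro s
  rw [ContinuousAt, tendsto_iff_norm_sub_tendsto_zero]
  set κ : ℝ := 3 ^ (1 / 4 : ℝ)
  have hlim : Tendsto (fun t => κ * ‖u t - u s‖ * (κ * ‖v t‖) + κ * ‖u s‖ * (κ * ‖v t - v s‖))
      (𝓝 s) (𝓝 (κ * ‖u s - u s‖ * (κ * ‖v s‖) + κ * ‖u s‖ * (κ * ‖v s - v s‖))) :=
    Continuous.tendsto (by fun_prop) s
  simp only [sub_self, norm_zero, mul_zero, zero_mul, add_zero] at hlim
  refine squeeze_zero (fun _ => norm_nonneg _) (fun t => ?_) hlim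
  have e : (hV.memLp_mul (huV t) (hvV t)).toLp - (hV.memLp_mul (huV s) (hvV s)).toLp =
      (hV.memLp_mul (sub_mem (huV t) (huV s)) (hvV t)).toLp +
        (hV.memLp_mul (huV s) (sub_mem (hvV t) (hvV s))).toLp := by
    rw [← MemLp.toLp_sub, ← MemLp.toLp_add]
    apply MemLp.toLp_congr
    filter_upwards [Lp.coeFn_sub (u t) (u s), Lp.coeFn_sub (v t) (v s)] with ω h1 h2
    simp only [Pi.sub_apply, Pi.add_apply, h1, h2]
    ring
  rw [e]
  exact (norm_add_le _ _).trans (add_le_add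
    (hV.norm_toLp_mul_le (sub_mem (huV t) (huV s)) (hvV t))
    (hV.norm_toLp_mul_le (huV s) (sub_mem (hvV t) (hvV s))))

/-- The closed linear span of a centred Gaussian process has Gaussian moments. -/
theorem ProbabilityTheory.IsGaussianProcess.hasGaussianMoments [IsProbabilityMeasure P] {T : Type*}
    {X : T → Ω → ℝ} (hX : IsGaussianProcess X P) (h0 : ∀ t, ∫ ω, X t ω ∂P = 0) :
    HasGaussianMoments (Submodule.span ℝ
      (range fun t => (hX.hasGaussianLaw_eval t).memLp_two.toLp)).topologicalClosure := by
  refine HasGaussianMoments.topologicalClosure ?_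
  intro ξ hξ
  obtain ⟨w, rfl⟩ := (Finsupp.mem_span_range_iff_exists_finsupp).1 hξ
  have hae : ((w.sum fun t r => r • (hX.hasGaussianLaw_eval t).memLp_two.toLp : Lp ℝ 2 P) :
      Ω → ℝ) =ᵐ[P] fun ω => ∑ t ∈ w.support, w t • X t ω := by
    rw [Finsupp.sum]
    refine (Lp.coeFn_fun_finsetSum _ _).trans ?_
    have : ∀ t ∈ w.support, ((w t • (hX.hasGaussianLaw_eval t).memLp_two.toLp : Lp ℝ 2 P) : Ω → ℝ)
        =ᵐ[P] fun ω => w t • X t ω := by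
      intro t _
      filter_upwards [Lp.coeFn_smul (w t) (hX.hasGaussianLaw_eval t).memLp_two.toLp,
        (hX.hasGaussianLaw_eval t).memLp_two.coeFn_toLp] with ω h1 h2
      rw [h1, Pi.smul_apply, h2]
    filter_upwards [(ae_ball_iff w.support.countable_toSet).2 this] with ω hω
    exact Finset.sum_congr rfl fun t ht => hω t ht
  rw [eLpNorm_congr_ae hae, eLpNorm_congr_ae hae]
  -- Joint Gaussianity enters here: finite linear combinations of the process are Gaussian.
  have hG : HasGaussianLaw (fun ω => ∑ t ∈ w.support, w t • X t ω) P :=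
    (hX.smul w).hasGaussianLaw_fun_sum
  refine eLpNorm_four_eq_of_integral_pow_four hG.memLp_two (hG.memLp (by norm_num))
    (hG.integral_pow_four ?_)
  rw [integral_finsetSum _ fun t _ => ((hX.hasGaussianLaw_eval t).integrable.fun_smul (w t))]
  refine Finset.sum_eq_zero fun t _ => ?_
  rw [integral_smul, h0, smul_zero]

end GaussianMoments

/-! ### Fourier integrals and convolution -/

theorem MeasureTheory.Integrable.complex_ofReal {α : Type*} [MeasurableSpace α] {μ : Measure α}
    {h : α → ℝ} (hh : Integrable h μ) : Integrable (fun u => (h u : ℂ)) μ :=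
  hh.ofReal

theorem MeasureTheory.MemLp.complex_ofReal {α : Type*} [MeasurableSpace α] {μ : Measure α}
    {h : α → ℝ} {p : ENNReal} (hh : MemLp h p μ) : MemLp (fun u => (h u : ℂ)) p μ :=
  hh.ofReal

theorem fourierInv_real_eq_integral (g : ℝ → ℂ) (w : ℝ) :
    𝓕⁻ g w = ∫ ν, (𝐞 (ν * w) : ℂ) * g ν := by
  rw [Real.fourierInv_eq]
  refine integral_congr_ae (Eventually.of_forall fun ν => ?_)
  simp only [Circle.smul_def, smul_eq_mul, RCLike.inner_apply, conj_trivial]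
  rw [mul_comm w ν]

theorem fourier_real_eq_integral (g : ℝ → ℂ) (w : ℝ) :
    𝓕 g w = ∫ ν, (𝐞 (-(ν * w)) : ℂ) * g ν := by
  rw [Real.fourier_real_eq]
  refine integral_congr_ae (Eventually.of_forall fun ν => ?_)
  simp only [Circle.smul_def, smul_eq_mul]

theorem norm_fourier_le (g : ℝ → ℂ) (w : ℝ) : ‖𝓕 g w‖ ≤ ∫ ν, ‖g ν‖ :=
  VectorFourier.norm_fourierIntegral_le_integral_norm _ _ _ _ _

theorem norm_fourierInv_le (g : ℝ → ℂ) (w : ℝ) : ‖𝓕⁻ g w‖ ≤ ∫ ν, ‖g ν‖ := by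
  rw [Real.fourierInv_eq_fourier_neg]
  exact norm_fourier_le g _

theorem integrable_mul_fourier {g h : ℝ → ℂ} (hg : Integrable g) (hh : Integrable h) :
    Integrable fun ν => g ν * 𝓕 h ν :=
  hg.mul_bdd (continuous_fourier hh).aestronglyMeasurable
    (Eventually.of_forall (norm_fourier_le h))

/-- Fubini: the factor `𝐞 (-(u ν))` of the shifted kernel assembles `𝓕 h`. Applied to covariances,
it says that filtering multiplies the spectral density by the transfer function. -/
theorem integral_mul_fourierInv_sub {g h : ℝ → ℂ} (hg : Integrable g) (hh : Integrable h) (w : ℝ) :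
    ∫ u, h u * 𝓕⁻ g (w - u) = 𝓕⁻ (fun ν => g ν * 𝓕 h ν) w := by
  have hI : Integrable (fun p : ℝ × ℝ => (𝐞 (p.2 * (w - p.1)) : ℂ) * (h p.1 * g p.2))
      (volume.prod volume) := by
    refine (hh.mul_prod hg).bdd_mul (c := 1) ?_ (Eventually.of_forall fun p => ?_)
    · exact Continuous.aestronglyMeasurable (by fun_prop)
    · exact (Circle.norm_coe _).le
  calc ∫ u, h u * 𝓕⁻ g (w - u)
      = ∫ u, ∫ ν, (𝐞 (ν * (w - u)) : ℂ) * (h u * g ν) := by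
        refine integral_congr_ae (Eventually.of_forall fun u => ?_)
        dsimp only
        rw [fourierInv_real_eq_integral, ← integral_const_mul]
        refine integral_congr_ae (Eventually.of_forall fun ν => ?_)
        dsimp only
        ring
    _ = ∫ ν, ∫ u, (𝐞 (ν * (w - u)) : ℂ) * (h u * g ν) := integral_integral_swap hI
    _ = _ := by
        rw [fourierInv_real_eq_integral]
        refine integral_congr_ae (Eventually.of_forall fun ν => ?_)
        dsimp only
        rw [fourier_real_eq_integral, ← integral_const_mul, ← integral_const_mul]
        refine integral_congr_ae (Eventually.of_forall fun u => ?_)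
        dsimp only
        rw [show ν * (w - u) = ν * w + -(u * ν) by ring, AddChar.map_add_eq_mul, Circle.coe_mul]
        ring

theorem fourier_comp_neg_eq_conj (h : ℝ → ℝ) (ν : ℝ) :
    𝓕 (fun u => (h (-u) : ℂ)) ν = starRingEnd ℂ (𝓕 (fun u => (h u : ℂ)) ν) := by
  rw [fourier_real_eq_integral, fourier_real_eq_integral, ← integral_conj,
    ← integral_neg_eq_self]
  refine integral_congr_ae (Eventually.of_forall fun u => ?_)
  simp only [map_mul, Complex.conj_ofReal, neg_neg]
  rw [← Circle.coe_inv_eq_conj, ← AddChar.map_neg_eq_inv]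
  congr 3
  ring

theorem memLp_two_complex_ofReal_of_bounded {ρ : ℝ → ℝ} {M : ℝ} (hρ : Integrable ρ)
    (h0 : ∀ ν, 0 ≤ ρ ν) (hM : ∀ ν, ρ ν ≤ M) : MemLp (fun ν => (ρ ν : ℂ)) 2 volume := by
  rw [memLp_two_iff_integrable_sq_norm hρ.complex_ofReal.aestronglyMeasurable]
  refine (hρ.bdd_mul (c := M) hρ.aestronglyMeasurable
    (Eventually.of_forall fun ν => ?_)).congr (Eventually.of_forall fun ν => ?_)
  · rw [Real.norm_of_nonneg (h0 ν)]
    exact hM ν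
  · simp [pow_two]

/-! ### Filtered stationary curves in a Hilbert space -/

/-- A curve `x` in a Hilbert space whose Gram function `⟪x s, x t⟫` is the Fourier integral of a
bounded continuous integrable density `ρ ≥ 0`, evaluated at `s - t`. -/
structure IsSpectralCurve {E : Type*} [NormedAddCommGroup E] [InnerProductSpace ℝ E]
    (x : ℝ → E) (ρ : ℝ → ℝ) (M : ℝ) : Prop where
  inner_eq : ∀ s t, ((inner ℝ (x s) (x t) : ℝ) : ℂ) = 𝓕⁻ (fun ν => (ρ ν : ℂ)) (s - t)
  continuous_density : Continuous ρ
  density_nonneg : ∀ ν, 0 ≤ ρ ν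
  density_le : ∀ ν, ρ ν ≤ M
  integrable_density : Integrable ρ

/-- By stationarity `‖x t - x s‖² = 2 Re k(0) - 2 Re k(t - s)`, which tends to `0` as `t → s`. -/
theorem continuous_of_inner_eq {E : Type*} [NormedAddCommGroup E] [InnerProductSpace ℝ E]
    {x : ℝ → E} {k : ℝ → ℂ} (hk : Continuous k)
    (h : ∀ s t, ((inner ℝ (x s) (x t) : ℝ) : ℂ) = k (s - t)) : Continuous x := by
  rw [continuous_iff_continuousAt]
  intro s
  rw [ContinuousAt, tendsto_iff_norm_sub_tendsto_zero]
  have hre : ∀ s t, inner ℝ (x s) (x t) = (k (s - t)).re := fun s t => by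
    rw [← h, Complex.ofReal_re]
  have hsq : ∀ t, ‖x t - x s‖ = Real.sqrt ((k 0).re - 2 * (k (t - s)).re + (k 0).re) := by
    intro t
    rw [← Real.sqrt_sq (norm_nonneg (x t - x s)), norm_sub_sq_real, hre,
      ← real_inner_self_eq_norm_sq, ← real_inner_self_eq_norm_sq, hre, hre, sub_self, sub_self]
  simp_rw [hsq]
  have : Continuous fun t => Real.sqrt ((k 0).re - 2 * (k (t - s)).re + (k 0).re) := by fun_prop
  have h0 := this.tendsto s
  have e : (k 0).re - 2 * (k (s - s)).re + (k 0).re = 0 := by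
    rw [sub_self]
    ring
  rwa [e, Real.sqrt_zero] at h0

/-- The convolution `∫ h(s) x(t - s) ds` of a curve in a Hilbert space with a scalar function. -/
noncomputable def curveConv {E : Type*} [NormedAddCommGroup E] [NormedSpace ℝ E]
    (x : ℝ → E) (h : ℝ → ℝ) (t : ℝ) : E :=
  ∫ s, h s • x (t - s)

namespace IsSpectralCurve

variable {E : Type*} [NormedAddCommGroup E] [InnerProductSpace ℝ E]
  {x : ℝ → E} {ρ : ℝ → ℝ} {M : ℝ}

theorem bound_nonneg (hx : IsSpectralCurve x ρ M) : 0 ≤ M :=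
  (hx.density_nonneg 0).trans (hx.density_le 0)

theorem continuous (hx : IsSpectralCurve x ρ M) : Continuous x :=
  continuous_of_inner_eq (continuous_fourierInv hx.integrable_density.complex_ofReal) hx.inner_eq

theorem norm_sq_eq (hx : IsSpectralCurve x ρ M) (t : ℝ) : ‖x t‖ ^ 2 = ‖x 0‖ ^ 2 := by
  have h : ((‖x t‖ ^ 2 : ℝ) : ℂ) = ((‖x 0‖ ^ 2 : ℝ) : ℂ) := by
    rw [← real_inner_self_eq_norm_sq, ← real_inner_self_eq_norm_sq, hx.inner_eq, hx.inner_eq,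
      sub_self, sub_self]
  exact_mod_cast h

theorem norm_eq (hx : IsSpectralCurve x ρ M) (t : ℝ) : ‖x t‖ = ‖x 0‖ :=
  (sq_eq_sq₀ (norm_nonneg _) (norm_nonneg _)).1 (hx.norm_sq_eq t)

theorem integrable_smul (hx : IsSpectralCurve x ρ M) {h : ℝ → ℝ} (hh : Integrable h) (t : ℝ) :
    Integrable fun s => h s • x (t - s) :=
  hh.smul_bdd ‖x 0‖ (hx.continuous.comp (continuous_sub_left t)).aestronglyMeasurable
    (Eventually.of_forall fun _ => (hx.norm_eq _).le)

theorem inner_curveConv_left [CompleteSpace E] (hx : IsSpectralCurve x ρ M) {h : ℝ → ℝ}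
    (hh : Integrable h) (t s : ℝ) : ((inner ℝ (curveConv x h t) (x s) : ℝ) : ℂ) =
      𝓕⁻ (fun ν => (ρ ν : ℂ) * 𝓕 (fun u => (h u : ℂ)) ν) (t - s) := by
  rw [real_inner_comm, curveConv, ← integral_inner (hx.integrable_smul hh t),
    ← integral_complex_ofReal,
    ← integral_mul_fourierInv_sub hx.integrable_density.complex_ofReal hh.complex_ofReal]
  refine integral_congr_ae (Eventually.of_forall fun u => ?_)
  dsimp only
  rw [real_inner_smul_right, real_inner_comm, Complex.ofReal_mul, hx.inner_eq,
    sub_right_comm]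

theorem inner_curveConv [CompleteSpace E] (hx : IsSpectralCurve x ρ M) {h : ℝ → ℝ}
    (hh : Integrable h) (t s : ℝ) : ((inner ℝ (curveConv x h t) (curveConv x h s) : ℝ) : ℂ) =
      𝓕⁻ (fun ν => (ρ ν : ℂ) * 𝓕 (fun u => (h u : ℂ)) ν *
        starRingEnd ℂ (𝓕 (fun u => (h u : ℂ)) ν)) (t - s) := by
  have hneg : Integrable fun u => (h (-u) : ℂ) := hh.comp_neg.complex_ofReal
  have e := integral_mul_fourierInv_sub (integrable_mul_fourier hx.integrable_density.complex_ofReal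
    hh.complex_ofReal) hneg (t - s)
  simp only [fourier_comp_neg_eq_conj] at e
  refine Eq.trans ?_ e
  -- Filtering the second argument is convolution with `u ↦ h (-u)`, whose transform is the
  -- conjugate of `𝓕 h` because `h` is real.
  rw [← integral_neg_eq_self]
  rw [curveConv.eq_def x h s, ← integral_inner (hx.integrable_smul hh s), ← integral_complex_ofReal]
  refine integral_congr_ae (Eventually.of_forall fun u => ?_)
  dsimp only
  rw [real_inner_smul_right, Complex.ofReal_mul, hx.inner_curveConv_left hh, neg_neg,
    show t - (s - u) = t - s - -u by ring]

/-- The squared norm is `∫ ρ |𝓕 h|²`, so boundedness of the density and Plancherel suffice. This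
estimate is what extends filtering from integrable `h` to square-integrable `H`. -/
theorem norm_curveConv_le [CompleteSpace E] (hx : IsSpectralCurve x ρ M) {h : ℝ → ℝ}
    (hh : Integrable h) (h2 : MemLp h 2 volume) (t : ℝ) :
    ‖curveConv x h t‖ ^ 2 ≤ M * ‖h2.complex_ofReal.toLp‖ ^ 2 := by
  have e := hx.inner_curveConv hh t t
  rw [real_inner_self_eq_norm_sq, sub_self, fourierInv_real_eq_integral] at e
  have hF := Lp.fourier_toLp_ae_eq hh.complex_ofReal h2.complex_ofReal
  have e' : ((‖curveConv x h t‖ ^ 2 : ℝ) : ℂ) = ∫ ν, (ρ ν : ℂ) *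
      ((𝓕 h2.complex_ofReal.toLp : Lp ℂ 2 (volume : Measure ℝ)) ν *
        starRingEnd ℂ ((𝓕 h2.complex_ofReal.toLp : Lp ℂ 2 (volume : Measure ℝ)) ν)) := by
    rw [e]
    apply integral_congr_ae
    filter_upwards [hF] with ν hν
    rw [hν]
    simp [mul_assoc]
  have hb := norm_integral_mul_conj_le (μ := (volume : Measure ℝ)) hx.bound_nonneg
    (k := fun ν => (ρ ν : ℂ)) (fun ν => by
      rw [Complex.norm_real, Real.norm_of_nonneg (hx.density_nonneg ν)]
      exact hx.density_le ν) (𝓕 h2.complex_ofReal.toLp) (𝓕 h2.complex_ofReal.toLp)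
  rw [← e', Complex.norm_real, Real.norm_of_nonneg (sq_nonneg _), Lp.norm_fourier_eq] at hb
  rwa [pow_two ‖h2.complex_ofReal.toLp‖]

end IsSpectralCurve

/-! ### Truncation -/

theorem tendsto_toLp_indicator_Ioc {H : ℝ → ℝ} (hH : MemLp H 2 (volume : Measure ℝ)) :
    Tendsto (fun p : ℝ × ℝ =>
        ((hH.indicator (measurableSet_Ioc (a := p.1) (b := p.2))).complex_ofReal).toLp)
      (atBot ×ˢ atTop) (𝓝 hH.complex_ofReal.toLp) := by
  rw [Lp.tendsto_Lp_iff_tendsto_eLpNorm'']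
  refine tendsto_eLpNorm_two_of_dominated (G := fun u => |H u|) ?_ ?_ hH.abs ?_ ?_
  · exact Eventually.of_forall fun p =>
      ((hH.indicator (measurableSet_Ioc (a := p.1) (b := p.2))).complex_ofReal).1
  · exact hH.complex_ofReal.1
  · refine Eventually.of_forall fun p => Eventually.of_forall fun u => ?_
    by_cases hu : u ∈ Ioc p.1 p.2
    · simp [hu]
    · simp [hu]
  · refine Eventually.of_forall fun u => ?_
    refine tendsto_const_nhds.congr' ?_
    filter_upwards [(eventually_lt_atBot u).prod_mk (eventually_ge_atTop u)] with p hp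
    rw [indicator_of_mem (show u ∈ Ioc p.1 p.2 from ⟨hp.1, hp.2⟩)]

theorem integrable_indicator_Ioc {H : ℝ → ℝ} (hH : MemLp H 2 (volume : Measure ℝ)) (p : ℝ × ℝ) :
    Integrable ((Ioc p.1 p.2).indicator H) :=
  (integrable_indicator_iff measurableSet_Ioc).2
    ((hH.locallyIntegrable (by norm_num)).integrableOn_isCompact isCompact_Icc |>.mono_set
      Ioc_subset_Icc_self)

/-- Filtering is Lipschitz with constant `√M` for the `L²` norm of the filter, so it carries the
Cauchy family of truncations of `H` to a Cauchy family in `E`. -/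
theorem IsSpectralCurve.exists_tendsto_curveConv {E : Type*} [NormedAddCommGroup E]
    [InnerProductSpace ℝ E] [CompleteSpace E] {x : ℝ → E} {ρ : ℝ → ℝ} {M : ℝ}
    (hx : IsSpectralCurve x ρ M) {H : ℝ → ℝ} (hH : MemLp H 2 (volume : Measure ℝ)) (t : ℝ) :
    ∃ y, Tendsto (fun p : ℝ × ℝ => curveConv x ((Ioc p.1 p.2).indicator H) t)
      (atBot ×ˢ atTop) (𝓝 y) := by
  have hlim := tendsto_toLp_indicator_Ioc hH
  have hc := hlim.cauchy_map
  rw [cauchy_map_iff, tendsto_uniformity_iff_dist_tendsto_zero] at hc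
  refine CompleteSpace.complete (f := map _ _) ?_
  rw [cauchy_map_iff, tendsto_uniformity_iff_dist_tendsto_zero]
  refine ⟨hc.1, squeeze_zero (fun _ => dist_nonneg) (fun q => ?_)
    (by simpa only [mul_zero] using hc.2.const_mul (Real.sqrt M))⟩
  dsimp only
  have h1 := integrable_indicator_Ioc hH q.1
  have h2 := integrable_indicator_Ioc hH q.2
  have m1 := hH.indicator (measurableSet_Ioc (a := q.1.1) (b := q.1.2))
  have m2 := hH.indicator (measurableSet_Ioc (a := q.2.1) (b := q.2.2))
  have e : curveConv x ((Ioc q.1.1 q.1.2).indicator H) t -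
      curveConv x ((Ioc q.2.1 q.2.2).indicator H) t =
        curveConv x ((Ioc q.1.1 q.1.2).indicator H - (Ioc q.2.1 q.2.2).indicator H) t := by
    rw [curveConv, curveConv, curveConv,
      ← integral_sub (hx.integrable_smul h1 t) (hx.integrable_smul h2 t)]
    simp only [Pi.sub_apply, sub_smul]
  have hle := hx.norm_curveConv_le (h1.sub h2) (m1.sub m2) t
  have e2 : ((m1.sub m2).complex_ofReal).toLp = (m1.complex_ofReal).toLp -
      (m2.complex_ofReal).toLp := by
    rw [← MemLp.toLp_sub]
    congr 1
    ext u
    simp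
  rw [dist_eq_norm, dist_eq_norm, e, ← Real.sqrt_sq (norm_nonneg (curveConv x _ t))]
  rw [e2] at hle
  refine (Real.sqrt_le_sqrt hle).trans (le_of_eq ?_)
  rw [Real.sqrt_mul hx.bound_nonneg, Real.sqrt_sq (norm_nonneg _)]

theorem IsSpectralCurve.memLp_two {E : Type*} [NormedAddCommGroup E]
    [InnerProductSpace ℝ E] {x : ℝ → E} {ρ : ℝ → ℝ} {M : ℝ}
    (hx : IsSpectralCurve x ρ M) : MemLp (fun ν => (ρ ν : ℂ)) 2 volume :=
  memLp_two_complex_ofReal_of_bounded hx.integrable_density hx.density_nonneg hx.density_le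

/-! ### Covariances of the output -/

section Response

variable {E : Type*} [NormedAddCommGroup E] [InnerProductSpace ℝ E] [CompleteSpace E]
  {x : ℝ → E} {ρ : ℝ → ℝ} {M : ℝ} {H : ℝ → ℝ} {t s : ℝ} {y z : E}

theorem tendsto_fourier_toLp_indicator_Ioc (hH : MemLp H 2 (volume : Measure ℝ)) :
    Tendsto (fun p : ℝ × ℝ =>
        (𝓕 (hH.indicator (measurableSet_Ioc (a := p.1) (b := p.2))).complex_ofReal.toLp :
          Lp ℂ 2 (volume : Measure ℝ)))
      (atBot ×ˢ atTop) (𝓝 (𝓕 hH.complex_ofReal.toLp)) :=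
  ((Lp.fourierTransformₗᵢ ℝ ℂ).continuous.tendsto _).comp (tendsto_toLp_indicator_Ioc hH)

/-- The density is bounded and integrable, hence in `L²`, and can be paired with the `L²`-convergent
transforms of the truncations. -/
theorem IsSpectralCurve.inner_response_left (hx : IsSpectralCurve x ρ M)
    (hH : MemLp H 2 (volume : Measure ℝ))
    (hy : Tendsto (fun p : ℝ × ℝ => curveConv x ((Ioc p.1 p.2).indicator H) t)
      (atBot ×ˢ atTop) (𝓝 y)) :
    ((inner ℝ y (x s) : ℝ) : ℂ) = 𝓕⁻ (fun ν => (ρ ν : ℂ) *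
      (𝓕 hH.complex_ofReal.toLp : Lp ℂ 2 (volume : Measure ℝ)) ν) (t - s) := by
  have h1 : Tendsto (fun p : ℝ × ℝ =>
      ((inner ℝ (curveConv x ((Ioc p.1 p.2).indicator H) t) (x s) : ℝ) : ℂ)) (atBot ×ˢ atTop)
      (𝓝 ((inner ℝ y (x s) : ℝ) : ℂ)) :=
    (Complex.continuous_ofReal.tendsto _).comp (hy.inner tendsto_const_nhds)
  have h2 := tendsto_integral_mul_conj_sub (μ := (volume : Measure ℝ)) (C := 1)
    (k := fun (_ : ℝ × ℝ) ν => (𝐞 (ν * (t - s)) : ℂ))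
    (fun _ => Continuous.aestronglyMeasurable (by fun_prop)) (fun _ ν => (Circle.norm_coe _).le)
    (tendsto_fourier_toLp_indicator_Ioc hH) (tendsto_const_nhds (x := hx.memLp_two.toLp))
  rw [tendsto_sub_nhds_zero_iff] at h2
  have e : 𝓕⁻ (fun ν => (ρ ν : ℂ) *
      (𝓕 hH.complex_ofReal.toLp : Lp ℂ 2 (volume : Measure ℝ)) ν) (t - s) =
      ∫ ν, (𝐞 (ν * (t - s)) : ℂ) * ((𝓕 hH.complex_ofReal.toLp : Lp ℂ 2 (volume : Measure ℝ)) ν *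
        starRingEnd ℂ ((hx.memLp_two.toLp : Lp ℂ 2 (volume : Measure ℝ)) ν)) := by
    rw [fourierInv_real_eq_integral]
    apply integral_congr_ae
    filter_upwards [hx.memLp_two.coeFn_toLp] with ν hν
    rw [hν, Complex.conj_ofReal]
    ring
  rw [e]
  refine tendsto_nhds_unique h1 (h2.congr fun p => ?_)
  have hi := integrable_indicator_Ioc hH p
  rw [hx.inner_curveConv_left hi, fourierInv_real_eq_integral]
  apply integral_congr_ae
  filter_upwards [hx.memLp_two.coeFn_toLp, Lp.fourier_toLp_ae_eq hi.complex_ofReal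
    (hH.indicator (measurableSet_Ioc (a := p.1) (b := p.2))).complex_ofReal] with ν hν hν'
  rw [hν, hν', Complex.conj_ofReal]
  ring

/-- Here both `L²` factors of the pairing are transforms of truncations, so the density moves into
the bounded weight. -/
theorem IsSpectralCurve.inner_response (hx : IsSpectralCurve x ρ M)
    (hH : MemLp H 2 (volume : Measure ℝ))
    (hy : Tendsto (fun p : ℝ × ℝ => curveConv x ((Ioc p.1 p.2).indicator H) t)
      (atBot ×ˢ atTop) (𝓝 y))
    (hz : Tendsto (fun p : ℝ × ℝ => curveConv x ((Ioc p.1 p.2).indicator H) s)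
      (atBot ×ˢ atTop) (𝓝 z)) :
    ((inner ℝ y z : ℝ) : ℂ) = 𝓕⁻ (fun ν => (ρ ν : ℂ) *
      (‖(𝓕 hH.complex_ofReal.toLp : Lp ℂ 2 (volume : Measure ℝ)) ν‖ : ℂ) ^ 2) (t - s) := by
  have h1 : Tendsto (fun p : ℝ × ℝ =>
      ((inner ℝ (curveConv x ((Ioc p.1 p.2).indicator H) t)
        (curveConv x ((Ioc p.1 p.2).indicator H) s) : ℝ) : ℂ)) (atBot ×ˢ atTop)
      (𝓝 ((inner ℝ y z : ℝ) : ℂ)) :=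
    (Complex.continuous_ofReal.tendsto _).comp (hy.inner hz)
  have h2 := tendsto_integral_mul_conj_sub (μ := (volume : Measure ℝ)) (C := M)
    (k := fun (_ : ℝ × ℝ) ν => (𝐞 (ν * (t - s)) : ℂ) * ρ ν)
    (fun _ => Continuous.aestronglyMeasurable (by have := hx.continuous_density; fun_prop))
    (fun _ ν => by
      rw [norm_mul, Circle.norm_coe, one_mul, Complex.norm_real,
        Real.norm_of_nonneg (hx.density_nonneg ν)]
      exact hx.density_le ν)
    (tendsto_fourier_toLp_indicator_Ioc hH) (tendsto_fourier_toLp_indicator_Ioc hH)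
  rw [tendsto_sub_nhds_zero_iff] at h2
  have e : 𝓕⁻ (fun ν => (ρ ν : ℂ) *
      (‖(𝓕 hH.complex_ofReal.toLp : Lp ℂ 2 (volume : Measure ℝ)) ν‖ : ℂ) ^ 2) (t - s) =
      ∫ ν, (𝐞 (ν * (t - s)) : ℂ) * ρ ν *
        ((𝓕 hH.complex_ofReal.toLp : Lp ℂ 2 (volume : Measure ℝ)) ν *
        starRingEnd ℂ ((𝓕 hH.complex_ofReal.toLp : Lp ℂ 2 (volume : Measure ℝ)) ν)) := by
    rw [fourierInv_real_eq_integral]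
    refine integral_congr_ae (Eventually.of_forall fun ν => ?_)
    dsimp only
    rw [Complex.mul_conj', mul_assoc]
  rw [e]
  refine tendsto_nhds_unique h1 (h2.congr fun p => ?_)
  have hi := integrable_indicator_Ioc hH p
  rw [hx.inner_curveConv hi, fourierInv_real_eq_integral]
  apply integral_congr_ae
  filter_upwards [Lp.fourier_toLp_ae_eq hi.complex_ofReal
    (hH.indicator (measurableSet_Ioc (a := p.1) (b := p.2))).complex_ofReal] with ν hν
  rw [hν]
  ring

end Response

/-! ### The Fejér kernel -/

/-- The Fourier integral `∫_0^T exp(2π i x t) dt` of the indicator of `(0, T]`. -/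
noncomputable def dirichletInt (T x : ℝ) : ℂ :=
  ∫ t in Ioc 0 T, (𝐞 (x * t) : ℂ)

theorem dirichletInt_eq_fourierInv (T : ℝ) :
    dirichletInt T = 𝓕⁻ ((Ioc 0 T).indicator fun _ => (1 : ℂ)) := by
  funext x
  rw [fourierInv_real_eq_integral, dirichletInt, ← integral_indicator measurableSet_Ioc]
  refine integral_congr_ae (Eventually.of_forall fun t => ?_)
  by_cases ht : t ∈ Ioc 0 T <;> simp [ht, mul_comm]

theorem continuous_dirichletInt (T : ℝ) : Continuous (dirichletInt T) := by
  rw [dirichletInt_eq_fourierInv]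
  exact continuous_fourierInv ((integrable_indicator_iff measurableSet_Ioc).2 (by simp))

theorem conj_dirichletInt (T x : ℝ) :
    starRingEnd ℂ (dirichletInt T x) = ∫ t in Ioc 0 T, (𝐞 (-(x * t)) : ℂ) := by
  rw [dirichletInt, ← integral_conj]
  refine integral_congr_ae (Eventually.of_forall fun t => ?_)
  dsimp only
  rw [← Circle.coe_inv_eq_conj, ← AddChar.map_neg_eq_inv]

theorem dirichletInt_eq_mul {T : ℝ} (hT : 0 < T) (x : ℝ) :
    dirichletInt T x = T * dirichletInt 1 (T * x) := by
  rw [dirichletInt, dirichletInt, ← intervalIntegral.integral_of_le hT.le,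
    ← intervalIntegral.integral_of_le zero_le_one]
  have h := intervalIntegral.integral_comp_mul_left (fun t => (𝐞 (x * t) : ℂ)) (a := 0) (b := 1)
    hT.ne'
  rw [mul_zero, mul_one] at h
  have e : ∀ t : ℝ, T * x * t = x * (T * t) := fun t => by ring
  simp only [e]
  rw [h, Complex.real_smul, Complex.ofReal_inv, ← mul_assoc,
    mul_inv_cancel₀ (by exact_mod_cast hT.ne'), one_mul]

/-- Plancherel for the indicator of `(0, 1]`; the second part normalizes the Fejér kernel
`|dirichletInt 1|²`. -/
theorem memLp_dirichletInt_and_integral : MemLp (dirichletInt 1) 2 volume ∧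
    ∫ v, ‖dirichletInt 1 v‖ ^ 2 = 1 := by
  have h1 : Integrable ((Ioc (0 : ℝ) 1).indicator fun _ => (1 : ℂ)) :=
    (integrable_indicator_iff measurableSet_Ioc).2 (by simp)
  have h2 : MemLp ((Ioc (0 : ℝ) 1).indicator fun _ => (1 : ℂ)) 2 volume :=
    memLp_indicator_const 2 measurableSet_Ioc 1 (Or.inr (by simp))
  have hae := Lp.fourierInv_toLp_ae_eq h1 h2
  rw [← dirichletInt_eq_fourierInv] at hae
  have hm := (memLp_congr_ae hae).1 (Lp.memLp _)
  refine ⟨hm, ?_⟩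
  have hn : ‖(𝓕⁻ h2.toLp : Lp ℂ 2 (volume : Measure ℝ))‖ ^ 2 = ‖h2.toLp‖ ^ 2 := by
    rw [← Lp.norm_fourier_eq, FourierTransform.fourier_fourierInv_eq]
  have key : ∀ g : Lp ℂ 2 (volume : Measure ℝ), ‖g‖ ^ 2 = ∫ v, ‖g v‖ ^ 2 := by
    intro g
    have := congrArg Complex.re (L2.inner_def (𝕜 := ℂ) g g)
    rw [inner_self_eq_norm_sq_to_K] at this
    have e : ∀ v, inner ℂ (g v) (g v) = ((‖g v‖ ^ 2 : ℝ) : ℂ) := fun v => by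
      rw [inner_self_eq_norm_sq_to_K]
      push_cast
      rfl
    simp only [e] at this
    rw [integral_complex_ofReal, Complex.ofReal_re] at this
    rw [← this]
    norm_cast
  rw [key, key] at hn
  have e1 : ∫ v, ‖dirichletInt 1 v‖ ^ 2 =
      ∫ v, ‖(𝓕⁻ h2.toLp : Lp ℂ 2 (volume : Measure ℝ)) v‖ ^ 2 := by
    apply integral_congr_ae
    filter_upwards [hae] with v hv
    rw [hv]
  have e2 : ∫ v, ‖(h2.toLp : Lp ℂ 2 (volume : Measure ℝ)) v‖ ^ 2 =
      ∫ v, (Ioc (0 : ℝ) 1).indicator (fun _ => (1 : ℝ)) v := by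
    apply integral_congr_ae
    filter_upwards [h2.coeFn_toLp] with v hv
    rw [hv]
    by_cases h : v ∈ Ioc (0 : ℝ) 1 <;> simp [h]
  rw [e1, hn, e2, integral_indicator measurableSet_Ioc]
  simp

/-- Lebesgue measure on the square `(0, T]²`. -/
noncomputable abbrev squareMeasure (T : ℝ) : Measure (ℝ × ℝ) :=
  (volume.restrict (Ioc 0 T)).prod (volume.restrict (Ioc 0 T))

theorem integral_square_fourierChar (T x : ℝ) :
    ∫ q, (𝐞 (x * (q.1 - q.2)) : ℂ) ∂(squareMeasure T) = (‖dirichletInt T x‖ : ℂ) ^ 2 := by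
  have e : ∀ q : ℝ × ℝ, (𝐞 (x * (q.1 - q.2)) : ℂ) = (𝐞 (x * q.1) : ℂ) * (𝐞 (-(x * q.2)) : ℂ) := by
    intro q
    rw [← Circle.coe_mul, ← AddChar.map_add_eq_mul]
    congr 2
    ring
  simp only [e]
  rw [integral_prod_mul (fun t => (𝐞 (x * t) : ℂ)) (fun t => (𝐞 (-(x * t)) : ℂ)),
    ← conj_dirichletInt, ← dirichletInt, Complex.mul_conj']

/-- Integrating over the square first leaves `𝐞 ((l + m)(t - s))` averaged over `t` and `s`, which
is the Fejér kernel at `l + m`. -/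
theorem integral_square_fourierInv_mul {g r : ℝ → ℂ} (hg : Integrable g) (hr : Integrable r)
    (T τ : ℝ) :
    ∫ q, 𝓕⁻ g (q.1 - q.2 + τ) * 𝓕⁻ r (q.1 - q.2) ∂(squareMeasure T) =
      ∫ l, ∫ m, (𝐞 (l * τ) : ℂ) * g l * (r m * (‖dirichletInt T (l + m)‖ : ℂ) ^ 2) := by
  have hI : Integrable (fun z : (ℝ × ℝ) × (ℝ × ℝ) =>
      (𝐞 (z.2.1 * τ + (z.2.1 + z.2.2) * (z.1.1 - z.1.2)) : ℂ) * (g z.2.1 * r z.2.2))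
      ((squareMeasure T).prod (volume.prod volume)) := by
    have h0 : Integrable (fun z : (ℝ × ℝ) × (ℝ × ℝ) => (1 : ℂ) * (g z.2.1 * r z.2.2))
        ((squareMeasure T).prod (volume.prod volume)) :=
      (integrable_const (1 : ℂ)).mul_prod (hg.mul_prod hr)
    simp only [one_mul] at h0
    refine h0.bdd_mul (c := 1) ?_ (Eventually.of_forall fun z => (Circle.norm_coe _).le)
    exact Continuous.aestronglyMeasurable (by fun_prop)
  calc ∫ q, 𝓕⁻ g (q.1 - q.2 + τ) * 𝓕⁻ r (q.1 - q.2) ∂(squareMeasure T)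
      = ∫ q, (∫ p : ℝ × ℝ, (𝐞 (p.1 * τ + (p.1 + p.2) * (q.1 - q.2)) : ℂ) * (g p.1 * r p.2))
          ∂(squareMeasure T) := by
        refine integral_congr_ae (Eventually.of_forall fun q => ?_)
        dsimp only
        rw [fourierInv_real_eq_integral, fourierInv_real_eq_integral, ← integral_prod_mul]
        refine integral_congr_ae (Eventually.of_forall fun p => ?_)
        dsimp only
        rw [show p.1 * τ + (p.1 + p.2) * (q.1 - q.2) = p.1 * (q.1 - q.2 + τ) + p.2 * (q.1 - q.2) by
          ring, AddChar.map_add_eq_mul, Circle.coe_mul]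
        ring
    _ = ∫ p : ℝ × ℝ, ∫ q, (𝐞 (p.1 * τ + (p.1 + p.2) * (q.1 - q.2)) : ℂ) * (g p.1 * r p.2)
          ∂(squareMeasure T) := integral_integral_swap hI
    _ = ∫ p : ℝ × ℝ, (𝐞 (p.1 * τ) : ℂ) * g p.1 *
          (r p.2 * (‖dirichletInt T (p.1 + p.2)‖ : ℂ) ^ 2) := by
        refine integral_congr_ae (Eventually.of_forall fun p => ?_)
        dsimp only
        rw [← integral_square_fourierChar, ← integral_const_mul, ← integral_const_mul]
        refine integral_congr_ae (Eventually.of_forall fun q => ?_)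
        dsimp only
        rw [AddChar.map_add_eq_mul, Circle.coe_mul]
        ring
    _ = _ := by
        rw [Measure.volume_eq_prod, integral_prod]
        -- Integrability in `(l, m)` is inherited from `hI` by integrating out the square.
        refine (hI.swap.integral_prod_left).congr (Eventually.of_forall fun p => ?_)
        dsimp only [Function.comp, Prod.swap]
        rw [← integral_square_fourierChar, ← integral_const_mul, ← integral_const_mul]
        refine integral_congr_ae (Eventually.of_forall fun q => ?_)
        dsimp only
        rw [AddChar.map_add_eq_mul, Circle.coe_mul]
        ring

/-- The substitution `m = -l + v / T` fixes the kernel and moves `T` into the argument of `r`. Of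
the factor `T²` from the scaling of the kernel, the Jacobian removes one `T`. -/
theorem integral_mul_dirichletInt_sq {T : ℝ} (hT : 0 < T) (r : ℝ → ℂ) (l : ℝ) :
    ∫ m, r m * (‖dirichletInt T (l + m)‖ : ℂ) ^ 2 =
      T * ∫ v, r (-l + v / T) * (‖dirichletInt 1 v‖ : ℂ) ^ 2 := by
  have h1 : ∫ v, r (-l + v / T) * (‖dirichletInt 1 v‖ : ℂ) ^ 2 =
      T * ∫ m, r (-l + m) * (‖dirichletInt 1 (T * m)‖ : ℂ) ^ 2 := by
    have := Measure.integral_comp_div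
      (fun m => r (-l + m) * (‖dirichletInt 1 (T * m)‖ : ℂ) ^ 2) T
    rw [abs_of_pos hT, Complex.real_smul] at this
    rw [← this]
    simp only [mul_div_cancel₀ _ hT.ne']
  have h2 : ∫ m, r (-l + m) * (‖dirichletInt 1 (T * m)‖ : ℂ) ^ 2 =
      ∫ m, r m * (‖dirichletInt 1 (T * (l + m))‖ : ℂ) ^ 2 := by
    rw [← integral_add_left_eq_self (fun m => r (-l + m) * (‖dirichletInt 1 (T * m)‖ : ℂ) ^ 2) l]
    simp only [neg_add_cancel_left]
  rw [h1, h2, ← mul_assoc, ← integral_const_mul]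
  refine integral_congr_ae (Eventually.of_forall fun m => ?_)
  dsimp only
  rw [dirichletInt_eq_mul hT, norm_mul, Complex.norm_real, Real.norm_of_nonneg hT.le]
  push_cast
  ring

/-! ### Flattening densities and the auto-covariance term, in the frequency domain -/

/-- A family of bounded densities that becomes flat, of height `c`, on every bounded set. -/
structure IsFlatteningFamily (ρ : ℝ → ℝ → ℝ) (c M : ℝ) : Prop where
  continuous : ∀ Δ, Continuous (ρ Δ)
  nonneg : ∀ Δ ν, 0 ≤ ρ Δ ν
  le : ∀ Δ ν, ρ Δ ν ≤ M
  integrable : ∀ Δ, Integrable (ρ Δ)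
  tendsto : ∀ a > 0, TendstoUniformlyOn ρ (fun _ => c) atTop (Icc (-a) a)

namespace IsFlatteningFamily

variable {ρ : ℝ → ℝ → ℝ} {c M : ℝ}

theorem bound_nonneg (hρ : IsFlatteningFamily ρ c M) : 0 ≤ M := (hρ.nonneg 0 0).trans (hρ.le 0 0)

theorem norm_le (hρ : IsFlatteningFamily ρ c M) (Δ ν : ℝ) : ‖(ρ Δ ν : ℂ)‖ ≤ M := by
  rw [Complex.norm_real, Real.norm_of_nonneg (hρ.nonneg Δ ν)]
  exact hρ.le Δ ν

/-- Local uniformity allows the evaluation point to move with the index. This is needed at `-l + v /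
T`, where `T` and `Δ` vary together. -/
theorem tendsto_comp (hρ : IsFlatteningFamily ρ c M) {ι : Type*} {F : Filter ι} {D p : ι → ℝ}
    {p₀ : ℝ} (hD : Tendsto D F atTop) (hp : Tendsto p F (𝓝 p₀)) :
    Tendsto (fun i => ρ (D i) (p i)) F (𝓝 c) := by
  rw [Metric.tendsto_nhds]
  intro ε hε
  have h1 := hD.eventually
    (Metric.tendstoUniformlyOn_iff.1 (hρ.tendsto (|p₀| + 1) (by positivity)) ε hε)
  have h2 : ∀ᶠ i in F, p i ∈ Icc (-(|p₀| + 1)) (|p₀| + 1) :=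
    hp.eventually (Icc_mem_nhds (by linarith [neg_abs_le p₀]) (by linarith [le_abs_self p₀]))
  filter_upwards [h1, h2] with i hi1 hi2
  rw [dist_comm]
  exact hi1 _ hi2

/-- The contribution of the auto-covariances to the limit. -/
theorem tendsto_auto (hρ : IsFlatteningFamily ρ c M) (G : Lp ℂ 2 (volume : Measure ℝ)) (τ : ℝ) :
    Tendsto (fun q : ℝ × ℝ => ((1 / q.1 : ℝ) : ℂ) *
      ∫ z, 𝓕⁻ (fun ν => (ρ q.2 ν : ℂ) * (‖G ν‖ : ℂ) ^ 2) (z.1 - z.2 + τ) *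
        𝓕⁻ (fun ν => (ρ q.2 ν : ℂ)) (z.1 - z.2) ∂(squareMeasure q.1)) (atTop ×ˢ atTop)
      (𝓝 ((c : ℂ) ^ 2 * ∫ ν, (𝐞 (ν * τ) : ℂ) * (‖G ν‖ : ℂ) ^ 2)) := by
  obtain ⟨hE, hE1⟩ := memLp_dirichletInt_and_integral
  have hG2 : Integrable fun ν => ‖G ν‖ ^ 2 := (Lp.memLp G).integrable_norm_pow (by norm_num)
  have hE2 : Integrable fun v => ‖dirichletInt 1 v‖ ^ 2 := hE.integrable_norm_pow (by norm_num)
  have hGm : AEStronglyMeasurable (fun z : ℝ × ℝ => G z.1) (volume.prod volume) :=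
    (Lp.aestronglyMeasurable G).comp_fst
  have hEc := continuous_dirichletInt 1
  have hM := hρ.bound_nonneg
  let F : ℝ × ℝ → ℝ × ℝ → ℂ := fun q z => (𝐞 (z.1 * τ) : ℂ) *
    ((ρ q.2 z.1 : ℂ) * (‖G z.1‖ : ℂ) ^ 2) *
      ((ρ q.2 (-z.1 + z.2 / q.1) : ℂ) * (‖dirichletInt 1 z.2‖ : ℂ) ^ 2)
  have hFm : ∀ q, AEStronglyMeasurable (F q) (volume.prod volume) := by
    intro q
    have hc := hρ.continuous q.2
    refine AEStronglyMeasurable.mul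
      (AEStronglyMeasurable.mul ?_ (AEStronglyMeasurable.mul ?_ ?_)) ?_
    · exact Continuous.aestronglyMeasurable (by fun_prop)
    · exact Continuous.aestronglyMeasurable (by fun_prop)
    · exact (Complex.continuous_ofReal.comp_aestronglyMeasurable hGm.norm).pow 2
    · exact Continuous.aestronglyMeasurable (by fun_prop)
  -- One integrable bound serves all `(T, Δ)`: both densities are estimated by `M`, and
  -- integrability comes from `|G|²` and the Fejér kernel.
  have hbI : Integrable (fun z : ℝ × ℝ => M ^ 2 * (‖G z.1‖ ^ 2 * ‖dirichletInt 1 z.2‖ ^ 2))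
      (volume.prod volume) := (hG2.mul_prod hE2).const_mul _
  have hFb : ∀ q z, ‖F q z‖ ≤ M ^ 2 * (‖G z.1‖ ^ 2 * ‖dirichletInt 1 z.2‖ ^ 2) := by
    intro q z
    simp only [F, norm_mul, norm_pow, Circle.norm_coe, Complex.norm_real, norm_norm, one_mul]
    have h1 := hρ.norm_le q.2 z.1
    have h2 := hρ.norm_le q.2 (-z.1 + z.2 / q.1)
    rw [Complex.norm_real] at h1 h2
    calc _ ≤ M * ‖G z.1‖ ^ 2 * (M * ‖dirichletInt 1 z.2‖ ^ 2) := by gcongr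
      _ = _ := by ring
  have hlim : Tendsto (fun q => ∫ z, F q z ∂(volume.prod volume)) (atTop ×ˢ atTop)
      (𝓝 (∫ z : ℝ × ℝ, ((𝐞 (z.1 * τ) : ℂ) * (‖G z.1‖ : ℂ) ^ 2) *
        ((c : ℂ) ^ 2 * (‖dirichletInt 1 z.2‖ : ℂ) ^ 2) ∂(volume.prod volume))) := by
    refine tendsto_integral_filter_of_dominated_convergence _ (Eventually.of_forall hFm)
      (Eventually.of_forall fun q => Eventually.of_forall (hFb q)) hbI
      (Eventually.of_forall fun z => ?_)
    have t1 : Tendsto (fun q : ℝ × ℝ => (ρ q.2 z.1 : ℂ)) (atTop ×ˢ atTop) (𝓝 (c : ℂ)) :=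
      (Complex.continuous_ofReal.tendsto _).comp
        (hρ.tendsto_comp tendsto_snd tendsto_const_nhds)
    have t2 : Tendsto (fun q : ℝ × ℝ => (ρ q.2 (-z.1 + z.2 / q.1) : ℂ)) (atTop ×ˢ atTop)
        (𝓝 (c : ℂ)) :=
      (Complex.continuous_ofReal.tendsto _).comp
        (hρ.tendsto_comp tendsto_snd
          (tendsto_const_nhds.add (tendsto_const_nhds.div_atTop tendsto_fst)))
    have := ((t1.mul_const ((‖G z.1‖ : ℂ) ^ 2)).const_mul (𝐞 (z.1 * τ) : ℂ)).mul
      (t2.mul_const ((‖dirichletInt 1 z.2‖ : ℂ) ^ 2))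
    convert! this using 2
    ring
  rw [integral_prod_mul (fun l => (𝐞 (l * τ) : ℂ) * (‖G l‖ : ℂ) ^ 2)
    (fun v => (c : ℂ) ^ 2 * (‖dirichletInt 1 v‖ : ℂ) ^ 2), integral_const_mul] at hlim
  have e1 : ∫ v, (‖dirichletInt 1 v‖ : ℂ) ^ 2 = 1 := by
    have : ∫ v, ((‖dirichletInt 1 v‖ ^ 2 : ℝ) : ℂ) = ((1 : ℝ) : ℂ) := by
      rw [integral_complex_ofReal, hE1]
    simpa using this
  rw [e1, mul_one, mul_comm] at hlim
  refine hlim.congr' ?_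
  filter_upwards [(eventually_gt_atTop (0 : ℝ)).prod_inl _] with q hq
  have hgI : Integrable fun ν => (ρ q.2 ν : ℂ) * (‖G ν‖ : ℂ) ^ 2 := by
    have : Integrable fun ν => ((‖G ν‖ ^ 2 : ℝ) : ℂ) := hG2.complex_ofReal
    push_cast at this
    exact this.bdd_mul (Complex.continuous_ofReal.comp (hρ.continuous q.2)).aestronglyMeasurable
      (Eventually.of_forall (hρ.norm_le q.2))
  rw [integral_square_fourierInv_mul hgI (hρ.integrable q.2).complex_ofReal,
    integral_prod _ (hbI.mono' (hFm q) (Eventually.of_forall (hFb q))), ← integral_const_mul]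
  refine integral_congr_ae (Eventually.of_forall fun l => ?_)
  dsimp only [F]
  rw [integral_const_mul, integral_const_mul, integral_mul_dirichletInt_sq hq]
  have : (q.1 : ℂ) ≠ 0 := by exact_mod_cast hq.ne'
  push_cast
  field_simp

end IsFlatteningFamily

/-! ### Averages over a square of a function of the difference -/

/-- The weight `(1 - |u| / T)₊`. -/
noncomputable def triangleWeight (T u : ℝ) : ℝ :=
  max (min T (T + u) - max 0 u) 0 / T

theorem continuous_triangleWeight (T : ℝ) : Continuous (triangleWeight T) := by
  unfold triangleWeight
  fun_prop

theorem abs_triangleWeight_le (T u : ℝ) : |triangleWeight T u| ≤ 1 := by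
  unfold triangleWeight
  -- For `T ≤ 0` the weight vanishes. The bound is later required at every index, not only
  -- eventually.
  rcases le_or_gt T 0 with hT | hT
  · rw [max_eq_right]
    · simp
    · linarith [min_le_left T (T + u), le_max_left 0 u]
  · rw [abs_of_nonneg (div_nonneg (le_max_right _ _) hT.le), div_le_one hT]
    exact max_le (by linarith [min_le_left T (T + u), le_max_left 0 u]) hT.le

theorem tendsto_triangleWeight (u : ℝ) : Tendsto (fun T => triangleWeight T u) atTop (𝓝 1) := by
  have h : Tendsto (fun T : ℝ => 1 - |u| / T) atTop (𝓝 (1 - 0)) :=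
    tendsto_const_nhds.sub (tendsto_const_nhds.div_atTop tendsto_id)
  rw [sub_zero] at h
  refine h.congr' ?_
  filter_upwards [eventually_gt_atTop (0 : ℝ), eventually_ge_atTop |u|] with T hT hu
  have e : min T (T + u) - max 0 u = T - |u| := by
    rcases le_total 0 u with h0 | h0
    · rw [abs_of_nonneg h0, min_eq_left (by linarith), max_eq_right h0]
    · rw [abs_of_nonpos h0, min_eq_right (by linarith), max_eq_left h0]
      ring
  rw [triangleWeight, e, max_eq_left (by linarith), sub_div, div_self hT.ne']

/-- With `u = t - s`, Fubini leaves the length of `(0, T] ∩ (u, T + u]`, which is `T` times the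
triangular weight when `T > 0`. -/
theorem integral_square_sub_eq {Φ : ℝ → ℂ} (hΦ : Integrable Φ) (hc : Continuous Φ) {C : ℝ}
    (hb : ∀ u, ‖Φ u‖ ≤ C) (T : ℝ) :
    ((1 / T : ℝ) : ℂ) * ∫ z, Φ (z.1 - z.2) ∂(squareMeasure T) =
      ∫ u, (triangleWeight T u : ℂ) * Φ u := by
  have hI : Integrable (fun z : ℝ × ℝ => Φ (z.1 - z.2)) (squareMeasure T) :=
    Integrable.of_bound (Continuous.aestronglyMeasurable (by fun_prop)) C
      (Eventually.of_forall fun z => hb _)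
  have hJ : Integrable (fun z : ℝ × ℝ => (Ioc 0 T).indicator (fun _ => (1 : ℂ)) (z.1 - z.2) * Φ z.2)
      ((volume.restrict (Ioc 0 T)).prod volume) := by
    have h0 : Integrable (fun z : ℝ × ℝ => (1 : ℂ) * Φ z.2)
        ((volume.restrict (Ioc 0 T)).prod volume) := (integrable_const (1 : ℂ)).mul_prod hΦ
    simp only [one_mul] at h0
    refine h0.bdd_mul (c := 1) ?_ (Eventually.of_forall fun z => ?_)
    · exact ((measurable_const.indicator measurableSet_Ioc).comp
        (measurable_fst.sub measurable_snd)).aestronglyMeasurable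
    · by_cases h : z.1 - z.2 ∈ Ioc 0 T
      · rw [indicator_of_mem h, norm_one]
      · rw [indicator_of_notMem h, norm_zero]
        exact zero_le_one
  have e1 : ∀ t, ∫ s in Ioc 0 T, Φ (t - s) =
      ∫ u, (Ioc 0 T).indicator (fun _ => (1 : ℂ)) (t - u) * Φ u := by
    intro t
    rw [← integral_indicator measurableSet_Ioc,
      ← integral_sub_left_eq_self (fun u => (Ioc 0 T).indicator (fun s => Φ (t - s)) u) volume t]
    refine integral_congr_ae (Eventually.of_forall fun u => ?_)
    dsimp only
    by_cases h : t - u ∈ Ioc 0 T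
    · rw [indicator_of_mem h, indicator_of_mem h, one_mul, sub_sub_cancel]
    · rw [indicator_of_notMem h, indicator_of_notMem h, zero_mul]
  rw [integral_prod _ hI]
  simp only [e1]
  rw [integral_integral_swap hJ, ← integral_const_mul]
  refine integral_congr_ae (Eventually.of_forall fun u => ?_)
  dsimp only
  rw [integral_mul_const, ← mul_assoc]
  congr 1
  have e2 : ∫ t in Ioc 0 T, (Ioc 0 T).indicator (fun _ => (1 : ℂ)) (t - u) =
      ((max (min T (T + u) - max 0 u) 0 : ℝ) : ℂ) := by
    have e3 : (fun t => (Ioc 0 T).indicator (fun _ => (1 : ℂ)) (t - u)) =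
        (Ioc u (T + u)).indicator (fun _ => (1 : ℂ)) := by
      funext t
      have : t - u ∈ Ioc 0 T ↔ t ∈ Ioc u (T + u) := by
        constructor
        · rintro ⟨h1, h2⟩
          exact ⟨by linarith, by linarith⟩
        · rintro ⟨h1, h2⟩
          exact ⟨by linarith, by linarith⟩
      by_cases h : t - u ∈ Ioc 0 T
      · rw [indicator_of_mem h, indicator_of_mem (this.1 h)]
      · rw [indicator_of_notMem h, indicator_of_notMem (fun h' => h (this.2 h'))]
    rw [e3, setIntegral_indicator measurableSet_Ioc, Ioc_inter_Ioc, setIntegral_const,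
      Real.volume_real_Ioc, Complex.real_smul, mul_one]
  rw [e2, triangleWeight]
  push_cast
  ring

/-! ### The cross-covariance term, in the time domain -/

namespace IsFlatteningFamily

variable {ρ : ℝ → ℝ → ℝ} {c M : ℝ}

theorem memLp_mul (hρ : IsFlatteningFamily ρ c M) {u : ℝ → ℂ} (hu : MemLp u 2 volume) (Δ : ℝ) :
    MemLp (fun ν => (ρ Δ ν : ℂ) * u ν) 2 volume :=
  (hu.norm.const_mul M).mono' ((Complex.continuous_ofReal.comp
    (hρ.continuous Δ)).aestronglyMeasurable.mul hu.1) (Eventually.of_forall fun ν => by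
      rw [norm_mul]
      exact mul_le_mul_of_nonneg_right (hρ.norm_le Δ ν) (norm_nonneg _))

theorem memLp_density (hρ : IsFlatteningFamily ρ c M) (Δ : ℝ) :
    MemLp (fun ν => (ρ Δ ν : ℂ)) 2 volume :=
  memLp_two_complex_ofReal_of_bounded (hρ.integrable Δ) (hρ.nonneg Δ) (hρ.le Δ)

theorem integrable_mul (hρ : IsFlatteningFamily ρ c M) {u : ℝ → ℂ} (hu : MemLp u 2 volume)
    (Δ : ℝ) : Integrable (fun ν => (ρ Δ ν : ℂ) * u ν) :=
  (hρ.memLp_density Δ).integrable_mul hu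

/-- The uniform bound and pointwise convergence of the densities are enough for dominated
convergence against a fixed `L²` function. -/
theorem tendsto_toLp_mul (hρ : IsFlatteningFamily ρ c M) {u : ℝ → ℂ} (hu : MemLp u 2 volume) :
    Tendsto (fun Δ => (hρ.memLp_mul hu Δ).toLp) atTop (𝓝 (hu.const_mul (c : ℂ)).toLp) := by
  rw [Lp.tendsto_Lp_iff_tendsto_eLpNorm'']
  refine tendsto_eLpNorm_two_of_dominated (G := fun ν => (M + |c|) * ‖u ν‖)
    (Eventually.of_forall fun Δ => (hρ.memLp_mul hu Δ).1) (hu.const_mul (c : ℂ)).1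
    (hu.norm.const_mul _) (Eventually.of_forall fun Δ => Eventually.of_forall fun ν => ?_)
    (Eventually.of_forall fun ν => ?_)
  · rw [← sub_mul, norm_mul]
    refine mul_le_mul_of_nonneg_right ((norm_sub_le _ _).trans (add_le_add (hρ.norm_le Δ ν) ?_))
      (norm_nonneg _)
    rw [Complex.norm_real, Real.norm_eq_abs]
  · exact ((Complex.continuous_ofReal.tendsto _).comp
      (hρ.tendsto_comp tendsto_id tendsto_const_nhds)).mul_const _

/-- The contribution of the cross-covariances to the limit. -/
theorem tendsto_cross (hρ : IsFlatteningFamily ρ c M) (G : Lp ℂ 2 (volume : Measure ℝ))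
    (τ₁ τ₂ : ℝ) :
    Tendsto (fun q : ℝ × ℝ => ((1 / q.1 : ℝ) : ℂ) *
      ∫ z, 𝓕⁻ (fun ν => (ρ q.2 ν : ℂ) * G ν) (z.1 - z.2 + τ₁) *
        𝓕⁻ (fun ν => (ρ q.2 ν : ℂ) * G ν) (z.2 - z.1 + τ₂) ∂(squareMeasure q.1)) (atTop ×ˢ atTop)
      (𝓝 ((c : ℂ) ^ 2 * ∫ ν, (𝐞 (ν * (τ₁ + τ₂)) : ℂ) * G ν ^ 2)) := by
  have hchar : ∀ τ : ℝ, MemLp (fun ν => (𝐞 (ν * τ) : ℂ) * G ν) 2 volume := fun τ =>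
    (Lp.memLp G).norm.mono' ((Continuous.aestronglyMeasurable (by fun_prop)).mul
      (Lp.aestronglyMeasurable G)) (Eventually.of_forall fun ν => by
        rw [norm_mul, Circle.norm_coe, one_mul])
  have hu := hchar τ₁
  have hv : MemLp (fun ν => starRingEnd ℂ ((𝐞 (ν * τ₂) : ℂ) * G ν)) 2 volume := (hchar τ₂).star
  have hA : ∀ Δ w, 𝓕⁻ (fun ν => (ρ Δ ν : ℂ) * G ν) (w + τ₁) =
      𝓕⁻ (fun ν => (ρ Δ ν : ℂ) * ((𝐞 (ν * τ₁) : ℂ) * G ν)) w := by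
    intro Δ w
    rw [fourierInv_real_eq_integral, fourierInv_real_eq_integral]
    refine integral_congr_ae (Eventually.of_forall fun ν => ?_)
    dsimp only
    rw [mul_add, AddChar.map_add_eq_mul, Circle.coe_mul]
    ring
  -- Since `ρ` is real, reflecting the argument is conjugation. The product of the two
  -- cross-covariances thereby takes the form `A w * conj (B w)` of an `L²` pairing.
  have hB : ∀ Δ w, 𝓕⁻ (fun ν => (ρ Δ ν : ℂ) * G ν) (-w + τ₂) = starRingEnd ℂ
      (𝓕⁻ (fun ν => (ρ Δ ν : ℂ) * starRingEnd ℂ ((𝐞 (ν * τ₂) : ℂ) * G ν)) w) := by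
    intro Δ w
    rw [fourierInv_real_eq_integral, fourierInv_real_eq_integral, ← integral_conj]
    refine integral_congr_ae (Eventually.of_forall fun ν => ?_)
    simp only [map_mul, Complex.conj_conj, Complex.conj_ofReal]
    rw [← Circle.coe_inv_eq_conj, ← AddChar.map_neg_eq_inv, mul_add, AddChar.map_add_eq_mul,
      Circle.coe_mul, mul_neg]
    ring
  let L := (Lp.fourierTransformₗᵢ ℝ ℂ).symm
  have tA : Tendsto (fun q : ℝ × ℝ => L (hρ.memLp_mul hu q.2).toLp) (atTop ×ˢ atTop)
      (𝓝 (L (hu.const_mul (c : ℂ)).toLp)) :=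
    (L.continuous.tendsto _).comp ((hρ.tendsto_toLp_mul hu).comp tendsto_snd)
  have tB : Tendsto (fun q : ℝ × ℝ => L (hρ.memLp_mul hv q.2).toLp) (atTop ×ˢ atTop)
      (𝓝 (L (hv.const_mul (c : ℂ)).toLp)) :=
    (L.continuous.tendsto _).comp ((hρ.tendsto_toLp_mul hv).comp tendsto_snd)
  have hkb : ∀ (q : ℝ × ℝ) (w : ℝ), ‖(triangleWeight q.1 w : ℂ)‖ ≤ 1 := fun q w => by
    rw [Complex.norm_real]
    exact abs_triangleWeight_le _ _
  have hkm : ∀ q : ℝ × ℝ, AEStronglyMeasurable (fun w => (triangleWeight q.1 w : ℂ)) volume :=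
    fun q => (Complex.continuous_ofReal.comp
      (continuous_triangleWeight q.1)).aestronglyMeasurable
  -- The two limits decouple: uniformly in the weight, `A` and `B` may be replaced by their limits
  -- as `Δ → ∞`. Only the weight, depending on `T`, then remains.
  have hdiff := tendsto_integral_mul_conj_sub (μ := (volume : Measure ℝ)) (C := 1)
    (k := fun (q : ℝ × ℝ) w => (triangleWeight q.1 w : ℂ)) hkm hkb tA tB
  set A₀ := L (hu.const_mul (c : ℂ)).toLp with hA₀
  set B₀ := L (hv.const_mul (c : ℂ)).toLp with hB₀
  have hmain : Tendsto (fun q : ℝ × ℝ => ∫ w, (triangleWeight q.1 w : ℂ) *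
      (A₀ w * starRingEnd ℂ (B₀ w))) (atTop ×ˢ atTop)
      (𝓝 (∫ w, A₀ w * starRingEnd ℂ (B₀ w))) := by
    have hI : Integrable fun w => A₀ w * starRingEnd ℂ (B₀ w) :=
      L2.integrable_inner (𝕜 := ℂ) B₀ A₀
    refine tendsto_integral_filter_of_dominated_convergence
      (fun w => ‖A₀ w * starRingEnd ℂ (B₀ w)‖)
      (Eventually.of_forall fun q => (hkm q).mul hI.aestronglyMeasurable)
      (Eventually.of_forall fun q => Eventually.of_forall fun w => ?_) hI.norm
      (Eventually.of_forall fun w => ?_)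
    · rw [norm_mul]
      exact mul_le_of_le_one_left (norm_nonneg _) (hkb q w)
    · have := ((Complex.continuous_ofReal.tendsto _).comp
        ((tendsto_triangleWeight w).comp
          (tendsto_fst (f := (atTop : Filter ℝ)) (g := (atTop : Filter ℝ))))).mul_const
            (A₀ w * starRingEnd ℂ (B₀ w))
      simpa [Function.comp_def] using this
  -- Parseval returns to the frequency side. The conjugate built into `hv` cancels the one in the
  -- inner product, leaving `G ^ 2` rather than `|G|²`.
  have hval : ∫ w, A₀ w * starRingEnd ℂ (B₀ w) =
      (c : ℂ) ^ 2 * ∫ ν, (𝐞 (ν * (τ₁ + τ₂)) : ℂ) * G ν ^ 2 := by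
    have h1 : ∫ w, A₀ w * starRingEnd ℂ (B₀ w) = inner ℂ B₀ A₀ := by
      rw [L2.inner_def]
      rfl
    rw [h1, hA₀, hB₀, LinearIsometryEquiv.inner_map_map, L2.inner_def, ← integral_const_mul]
    apply integral_congr_ae
    filter_upwards [(hu.const_mul (c : ℂ)).coeFn_toLp, (hv.const_mul (c : ℂ)).coeFn_toLp]
      with ν h1 h2
    rw [h1, h2, RCLike.inner_apply]
    simp only [map_mul, Complex.conj_conj, Complex.conj_ofReal]
    rw [mul_add, AddChar.map_add_eq_mul, Circle.coe_mul]
    ring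
  have hsum := hdiff.add hmain
  rw [zero_add, hval] at hsum
  refine hsum.congr fun q => ?_
  rw [sub_add_cancel]
  have hAi := hρ.integrable_mul hu q.2
  have hBi := hρ.integrable_mul hv q.2
  have hAae := Lp.fourierInv_toLp_ae_eq hAi (hρ.memLp_mul hu q.2)
  have hBae := Lp.fourierInv_toLp_ae_eq hBi (hρ.memLp_mul hv q.2)
  let A := 𝓕⁻ (fun ν => (ρ q.2 ν : ℂ) * ((𝐞 (ν * τ₁) : ℂ) * G ν))
  let B := 𝓕⁻ (fun ν => (ρ q.2 ν : ℂ) * starRingEnd ℂ ((𝐞 (ν * τ₂) : ℂ) * G ν))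
  have hABae : (fun w => (L (hρ.memLp_mul hu q.2).toLp) w *
      starRingEnd ℂ ((L (hρ.memLp_mul hv q.2).toLp) w)) =ᵐ[volume]
        fun w => A w * starRingEnd ℂ (B w) := by
    filter_upwards [hAae, hBae] with w h1 h2
    exact congrArg₂ (fun a b => a * starRingEnd ℂ b) h1 h2
  have hΦi : Integrable fun w => A w * starRingEnd ℂ (B w) :=
    (L2.integrable_inner (𝕜 := ℂ) (L (hρ.memLp_mul hv q.2).toLp)
      (L (hρ.memLp_mul hu q.2).toLp)).congr hABae
  have hAc : Continuous A := continuous_fourierInv hAi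
  have hBc : Continuous B := continuous_fourierInv hBi
  have hΦc : Continuous fun w => A w * starRingEnd ℂ (B w) :=
    hAc.mul (Complex.continuous_conj.comp hBc)
  have hsq := integral_square_sub_eq hΦi hΦc (fun w => by
    rw [norm_mul, RCLike.norm_conj]
    exact mul_le_mul (norm_fourierInv_le _ w) (norm_fourierInv_le _ w) (norm_nonneg _)
      ((norm_nonneg _).trans (norm_fourierInv_le _ w))) q.1
  have e : ∀ z : ℝ × ℝ, 𝓕⁻ (fun ν => (ρ q.2 ν : ℂ) * G ν) (z.1 - z.2 + τ₁) *
      𝓕⁻ (fun ν => (ρ q.2 ν : ℂ) * G ν) (z.2 - z.1 + τ₂) =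
        A (z.1 - z.2) * starRingEnd ℂ (B (z.1 - z.2)) := by
    intro z
    rw [hA, ← neg_sub z.1 z.2, hB]
  simp only [e]
  rw [hsq]
  apply integral_congr_ae
  filter_upwards [hABae] with w hw
  rw [hw]

end IsFlatteningFamily

/-! ### Integrals over a square -/

theorem Continuous.integrable_square {E : Type*} [NormedAddCommGroup E] {F : ℝ × ℝ → E}
    (hF : Continuous F) (T : ℝ) : Integrable F (squareMeasure T) := by
  rw [squareMeasure, Measure.prod_restrict]
  exact (hF.continuousOn.integrableOn_compact (isCompact_Icc.prod isCompact_Icc)).mono_set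
    (prod_mono Ioc_subset_Icc_self Ioc_subset_Icc_self)

theorem inner_integral_integral {E : Type*} [NormedAddCommGroup E] [InnerProductSpace ℝ E]
    [CompleteSpace E] {φ ψ : ℝ → E} (hφ : Continuous φ) (hψ : Continuous ψ) (T : ℝ) :
    inner ℝ (∫ t in Ioc 0 T, φ t) (∫ t in Ioc 0 T, ψ t) =
      ∫ z, inner ℝ (φ z.1) (ψ z.2) ∂(squareMeasure T) := by
  have hi : ∀ {φ : ℝ → E}, Continuous φ → Integrable φ (volume.restrict (Ioc 0 T)) := fun h =>
    (h.continuousOn.integrableOn_compact isCompact_Icc).mono_set Ioc_subset_Icc_self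
  rw [integral_prod _ (Continuous.integrable_square (by fun_prop) T), real_inner_comm,
    ← integral_inner (hi hφ)]
  refine integral_congr_ae (Eventually.of_forall fun t => ?_)
  dsimp only
  rw [real_inner_comm, ← integral_inner (hi hψ)]

/-! ### Gaussian processes as curves in `L²(Ω)` -/

section GaussianResponse

variable {Ω : Type*} [MeasurableSpace Ω] {P : Measure Ω}
  {x : ℝ → Ω → ℝ}

/-- A Gaussian process as a curve in `L²(Ω, P)`. -/
noncomputable def processLp (hg : IsGaussianProcess x P) (t : ℝ) : Lp ℝ 2 P :=
  (hg.hasGaussianLaw_eval t).memLp_two.toLp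

theorem coeFn_processLp (hg : IsGaussianProcess x P) (t : ℝ) : processLp hg t =ᵐ[P] x t :=
  (hg.hasGaussianLaw_eval t).memLp_two.coeFn_toLp

theorem inner_processLp (hg : IsGaussianProcess x P) (s t : ℝ) :
    inner ℝ (processLp hg s) (processLp hg t) = ∫ ω, x s ω * x t ω ∂P := by
  rw [L2.inner_def]
  apply integral_congr_ae
  filter_upwards [coeFn_processLp hg s, coeFn_processLp hg t] with ω h1 h2
  rw [h1, h2, RCLike.inner_apply, conj_trivial, mul_comm]

/-- The closed linear span of a Gaussian process in `L²(Ω, P)`. -/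
noncomputable def gaussianSpan (hg : IsGaussianProcess x P) : Submodule ℝ (Lp ℝ 2 P) :=
  (Submodule.span ℝ (range (processLp hg))).topologicalClosure

theorem processLp_mem (hg : IsGaussianProcess x P) (t : ℝ) : processLp hg t ∈ gaussianSpan hg :=
  Submodule.le_topologicalClosure _ (Submodule.subset_span (mem_range_self t))

variable {ρ : ℝ → ℝ} {M : ℝ}

/-- The closed span is the double orthogonal complement, and pairing with a vector orthogonal to
every `x t` commutes with the Bochner integral. -/
theorem curveConv_mem {hg : IsGaussianProcess x P} (hx : IsSpectralCurve (processLp hg) ρ M)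
    {h : ℝ → ℝ} (hh : Integrable h) (t : ℝ) : curveConv (processLp hg) h t ∈ gaussianSpan hg := by
  rw [gaussianSpan, ← Submodule.orthogonal_orthogonal_eq_closure, Submodule.mem_orthogonal]
  intro w hw
  rw [curveConv, ← integral_inner (hx.integrable_smul hh t)]
  refine integral_eq_zero_of_ae (Eventually.of_forall fun s => ?_)
  dsimp only
  rw [real_inner_smul_right, real_inner_comm,
    (Submodule.mem_orthogonal _ w).1 hw _ (Submodule.subset_span (mem_range_self (t - s)))]
  simp

variable {H : ℝ → ℝ}

/-- The output of the linear system, as a curve in `L²(Ω, P)`. -/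
noncomputable def responseLp {hg : IsGaussianProcess x P}
    (hx : IsSpectralCurve (processLp hg) ρ M) (hH : MemLp H 2 (volume : Measure ℝ)) (t : ℝ) :
    Lp ℝ 2 P :=
  (hx.exists_tendsto_curveConv hH t).choose

theorem tendsto_responseLp {hg : IsGaussianProcess x P}
    (hx : IsSpectralCurve (processLp hg) ρ M) (hH : MemLp H 2 (volume : Measure ℝ)) (t : ℝ) :
    Tendsto (fun p : ℝ × ℝ => curveConv (processLp hg) ((Ioc p.1 p.2).indicator H) t)
      (atBot ×ˢ atTop) (𝓝 (responseLp hx hH t)) :=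
  (hx.exists_tendsto_curveConv hH t).choose_spec

theorem responseLp_mem {hg : IsGaussianProcess x P}
    (hx : IsSpectralCurve (processLp hg) ρ M) (hH : MemLp H 2 (volume : Measure ℝ)) (t : ℝ) :
    responseLp hx hH t ∈ gaussianSpan hg :=
  (Submodule.isClosed_topologicalClosure _).mem_of_tendsto (tendsto_responseLp hx hH t)
    (Eventually.of_forall fun p => curveConv_mem hx (integrable_indicator_Ioc hH p) t)

theorem continuous_responseLp {hg : IsGaussianProcess x P}
    (hx : IsSpectralCurve (processLp hg) ρ M) (hH : MemLp H 2 (volume : Measure ℝ)) :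
    Continuous (responseLp hx hH) := by
  refine continuous_of_inner_eq (continuous_fourierInv ?_) fun t s =>
    hx.inner_response hH (tendsto_responseLp hx hH t) (tendsto_responseLp hx hH s)
  have h2 : Integrable fun ν =>
      ‖(𝓕 hH.complex_ofReal.toLp : Lp ℂ 2 (volume : Measure ℝ)) ν‖ ^ 2 :=
    (Lp.memLp _).integrable_norm_pow (by norm_num)
  have h3 := h2.complex_ofReal
  push_cast at h3
  refine h3.bdd_mul (c := M)
    (Complex.continuous_ofReal.comp hx.continuous_density).aestronglyMeasurable
    (Eventually.of_forall fun ν => ?_)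
  rw [Complex.norm_real, Real.norm_of_nonneg (hx.density_nonneg ν)]
  exact hx.density_le ν

/-- The covariance of two lagged products, by Isserlis' formula. -/
noncomputable def productCov {hg : IsGaussianProcess x P}
    (hx : IsSpectralCurve (processLp hg) ρ M) (hH : MemLp H 2 (volume : Measure ℝ))
    (τ₁ τ₂ : ℝ) (z : ℝ × ℝ) : ℝ :=
  inner ℝ (responseLp hx hH (z.1 + τ₁)) (responseLp hx hH (z.2 + τ₂)) *
      inner ℝ (processLp hg z.1) (processLp hg z.2) +
    inner ℝ (responseLp hx hH (z.1 + τ₁)) (processLp hg z.2) *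
      inner ℝ (processLp hg z.1) (responseLp hx hH (z.2 + τ₂))

theorem continuous_productCov {hg : IsGaussianProcess x P}
    (hx : IsSpectralCurve (processLp hg) ρ M) (hH : MemLp H 2 (volume : Measure ℝ))
    (τ₁ τ₂ : ℝ) : Continuous (productCov hx hH τ₁ τ₂) := by
  have h1 := continuous_responseLp hx hH
  have h2 := hx.continuous
  unfold productCov
  fun_prop

theorem productCov_eq {hg : IsGaussianProcess x P}
    (hx : IsSpectralCurve (processLp hg) ρ M) (hH : MemLp H 2 (volume : Measure ℝ))
    (τ₁ τ₂ : ℝ) (z : ℝ × ℝ) :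
    (productCov hx hH τ₁ τ₂ z : ℂ) =
      𝓕⁻ (fun ν => (ρ ν : ℂ) *
          (‖(𝓕 hH.complex_ofReal.toLp : Lp ℂ 2 (volume : Measure ℝ)) ν‖ : ℂ) ^ 2)
        (z.1 - z.2 + (τ₁ - τ₂)) * 𝓕⁻ (fun ν => (ρ ν : ℂ)) (z.1 - z.2) +
      𝓕⁻ (fun ν => (ρ ν : ℂ) * (𝓕 hH.complex_ofReal.toLp : Lp ℂ 2 (volume : Measure ℝ)) ν)
        (z.1 - z.2 + τ₁) *
      𝓕⁻ (fun ν => (ρ ν : ℂ) * (𝓕 hH.complex_ofReal.toLp : Lp ℂ 2 (volume : Measure ℝ)) ν)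
        (z.2 - z.1 + τ₂) := by
  rw [productCov, real_inner_comm (responseLp hx hH (z.2 + τ₂)) (processLp hg z.1)]
  push_cast
  rw [hx.inner_eq, hx.inner_response hH (tendsto_responseLp hx hH _) (tendsto_responseLp hx hH _),
    hx.inner_response_left hH (tendsto_responseLp hx hH _),
    hx.inner_response_left hH (tendsto_responseLp hx hH _),
    show z.1 + τ₁ - (z.2 + τ₂) = z.1 - z.2 + (τ₁ - τ₂) by ring, add_sub_right_comm,
    add_sub_right_comm]

variable [IsProbabilityMeasure P]

/-- By stationarity `E|x(t - s)| ≤ 1 + E x(0)²` for all `s`, so integrability of `h` suffices for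
Fubini. -/
theorem integrable_prod_mul_process {hg : IsGaussianProcess x P}
    (hx : IsSpectralCurve (processLp hg) ρ M) (hm : Measurable fun p : ℝ × Ω => x p.1 p.2)
    {h : ℝ → ℝ} (hh : Integrable h) (t : ℝ) :
    Integrable (fun p : ℝ × Ω => h p.1 * x (t - p.1) p.2) (volume.prod P) := by
  have hsm : AEStronglyMeasurable (fun p : ℝ × Ω => h p.1 * x (t - p.1) p.2) (volume.prod P) := by
    refine hh.aestronglyMeasurable.comp_fst.mul ?_
    have : Measurable fun p : ℝ × Ω => (t - p.1, p.2) := by fun_prop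
    exact (hm.comp this).aestronglyMeasurable
  rw [integrable_prod_iff hsm]
  refine ⟨Eventually.of_forall fun s =>
    (hg.hasGaussianLaw_eval (t - s)).integrable.const_mul (h s), ?_⟩
  refine (hh.norm.mul_const (1 + ‖processLp hg 0‖ ^ 2)).mono' hsm.norm.integral_prod_right'
    (Eventually.of_forall fun s => ?_)
  have hi := (hg.hasGaussianLaw_eval (t - s)).integrable
  have hsq : Integrable (fun ω => x (t - s) ω ^ 2) P :=
    (hg.hasGaussianLaw_eval (t - s)).memLp_two.integrable_sq
  have e : ∫ ω, x (t - s) ω ^ 2 ∂P = ‖processLp hg 0‖ ^ 2 := by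
    rw [← hx.norm_sq_eq (t - s), ← real_inner_self_eq_norm_sq, inner_processLp]
    simp only [pow_two]
  rw [Real.norm_of_nonneg (integral_nonneg fun ω => norm_nonneg _)]
  simp only [norm_mul]
  rw [integral_const_mul]
  refine mul_le_mul_of_nonneg_left ?_ (norm_nonneg _)
  rw [← e]
  have e1 : 1 + ∫ ω, x (t - s) ω ^ 2 ∂P = ∫ ω, (1 + x (t - s) ω ^ 2) ∂P := by
    rw [integral_add (integrable_const _) hsq]
    simp
  rw [e1]
  refine integral_mono hi.norm ((integrable_const _).add hsq) fun ω => ?_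
  dsimp only
  rw [Real.norm_eq_abs, ← sq_abs (x (t - s) ω)]
  nlinarith [sq_nonneg (|x (t - s) ω| - 1), abs_nonneg (x (t - s) ω)]

/-- Integration along the paths agrees with integration in `L²(Ω, P)`. -/
theorem integral_process_ae_eq_curveConv {hg : IsGaussianProcess x P}
    (hx : IsSpectralCurve (processLp hg) ρ M) (hm : Measurable fun p : ℝ × Ω => x p.1 p.2)
    {h : ℝ → ℝ} (hh : Integrable h) (t : ℝ) :
    (fun ω => ∫ s, h s * x (t - s) ω) =ᵐ[P] (curveConv (processLp hg) h t : Lp ℝ 2 P) := by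
  have hI := integrable_prod_mul_process hx hm hh t
  -- Over each measurable `A`, Fubini treats the path integral, and pairing with the indicator of
  -- `A` treats the Bochner integral.
  refine Integrable.ae_eq_of_forall_setIntegral_eq _ _ hI.integral_prod_right
    ((Lp.memLp _).integrable (by norm_num)) fun A hA _ => ?_
  have hIA : Integrable (fun p : ℝ × Ω => h p.1 * x (t - p.1) p.2)
      (volume.prod (P.restrict A)) := by
    have := hI.restrict (s := univ ×ˢ A)
    rwa [← Measure.prod_restrict, Measure.restrict_univ] at this
  have e1 : ∫ ω in A, ∫ s, h s * x (t - s) ω ∂volume ∂P =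
      ∫ s, ∫ ω in A, h s * x (t - s) ω ∂P := (integral_integral_swap hIA).symm
  rw [e1, ← L2.inner_indicatorConstLp_one (𝕜 := ℝ) hA (measure_ne_top P A), curveConv,
    ← integral_inner (hx.integrable_smul hh t)]
  refine integral_congr_ae (Eventually.of_forall fun s => ?_)
  dsimp only
  rw [integral_const_mul, real_inner_smul_right, L2.inner_indicatorConstLp_one]
  congr 1
  apply integral_congr_ae
  filter_upwards [ae_restrict_of_ae (coeFn_processLp hg (t - s))] with ω hω
  rw [hω]

theorem truncatedResponse_ae_eq {hg : IsGaussianProcess x P}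
    (hx : IsSpectralCurve (processLp hg) ρ M) (hm : Measurable fun p : ℝ × Ω => x p.1 p.2)
    (hH : MemLp H 2 (volume : Measure ℝ)) (t : ℝ) {p : ℝ × ℝ} (hp : p.1 ≤ p.2) :
    truncatedResponse H x t p =ᵐ[P]
      (curveConv (processLp hg) ((Ioc p.1 p.2).indicator H) t : Lp ℝ 2 P) := by
  refine Filter.EventuallyEq.trans (Eventually.of_forall fun ω => ?_)
    (integral_process_ae_eq_curveConv hx hm (integrable_indicator_Ioc hH p) t)
  dsimp only [truncatedResponse]
  rw [intervalIntegral.integral_of_le hp, ← integral_indicator measurableSet_Ioc]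
  refine integral_congr_ae (Eventually.of_forall fun s => ?_)
  by_cases hs : s ∈ Ioc p.1 p.2 <;> simp [hs]

theorem eventually_truncatedResponse_ae_eq {hg : IsGaussianProcess x P}
    (hx : IsSpectralCurve (processLp hg) ρ M) (hm : Measurable fun p : ℝ × Ω => x p.1 p.2)
    (hH : MemLp H 2 (volume : Measure ℝ)) (t : ℝ) :
    ∀ᶠ p : ℝ × ℝ in atBot ×ˢ atTop, truncatedResponse H x t p =ᵐ[P]
      (curveConv (processLp hg) ((Ioc p.1 p.2).indicator H) t : Lp ℝ 2 P) := by
  -- The interval integral is oriented, so it agrees with the indicator form once `a ≤ 0 ≤ b`.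
  filter_upwards [(eventually_le_atBot (0 : ℝ)).prod_mk (eventually_ge_atTop (0 : ℝ))] with p hp
  exact truncatedResponse_ae_eq hx hm hH t (hp.1.trans hp.2)

theorem isMSLimit_responseLp {hg : IsGaussianProcess x P}
    (hx : IsSpectralCurve (processLp hg) ρ M) (hm : Measurable fun p : ℝ × Ω => x p.1 p.2)
    (hH : MemLp H 2 (volume : Measure ℝ)) (t : ℝ) :
    IsMSLimit P (atBot ×ˢ atTop) (truncatedResponse H x t) (responseLp hx hH t) :=
  isMSLimit_of_tendsto_Lp (eventually_truncatedResponse_ae_eq hx hm hH t)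
    (tendsto_responseLp hx hH t)

theorem response_ae_eq {hg : IsGaussianProcess x P}
    (hx : IsSpectralCurve (processLp hg) ρ M) (hm : Measurable fun p : ℝ × Ω => x p.1 p.2)
    (hH : MemLp H 2 (volume : Measure ℝ)) (t : ℝ) :
    response P H x t =ᵐ[P] responseLp hx hH t := by
  have h := isMSLimit_responseLp hx hm hH t
  refine IsMSLimit.ae_eq ?_ h.isMSLimit_msLimit h
  filter_upwards [eventually_truncatedResponse_ae_eq hx hm hH t] with p hp
  exact (Lp.aestronglyMeasurable _).congr hp.symm

theorem hasGaussianMoments_gaussianSpan (hg : IsGaussianProcess x P)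
    (h0 : ∀ t, ∫ ω, x t ω ∂P = 0) : HasGaussianMoments (gaussianSpan hg) :=
  hg.hasGaussianMoments h0

/-- The lagged product `Y(t + τ) x(t)` as a curve in `L²(Ω, P)`. -/
noncomputable def productLp {hg : IsGaussianProcess x P}
    (hx : IsSpectralCurve (processLp hg) ρ M) (h0 : ∀ t, ∫ ω, x t ω ∂P = 0)
    (hH : MemLp H 2 (volume : Measure ℝ)) (τ t : ℝ) : Lp ℝ 2 P :=
  ((hasGaussianMoments_gaussianSpan hg h0).memLp_mul (responseLp_mem hx hH (t + τ))
    (processLp_mem hg t)).toLp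

theorem coeFn_productLp {hg : IsGaussianProcess x P}
    (hx : IsSpectralCurve (processLp hg) ρ M) (h0 : ∀ t, ∫ ω, x t ω ∂P = 0)
    (hH : MemLp H 2 (volume : Measure ℝ)) (τ t : ℝ) :
    productLp hx h0 hH τ t =ᵐ[P] fun ω => responseLp hx hH (t + τ) ω * processLp hg t ω :=
  MemLp.coeFn_toLp _

theorem continuous_productLp {hg : IsGaussianProcess x P}
    (hx : IsSpectralCurve (processLp hg) ρ M) (h0 : ∀ t, ∫ ω, x t ω ∂P = 0)
    (hH : MemLp H 2 (volume : Measure ℝ)) (τ : ℝ) : Continuous (productLp hx h0 hH τ) :=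
  (hasGaussianMoments_gaussianSpan hg h0).continuous_toLp_mul
    ((continuous_responseLp hx hH).comp (continuous_add_const τ)) hx.continuous
    (fun t => responseLp_mem hx hH (t + τ)) (processLp_mem hg)

theorem laggedProduct_ae_eq {hg : IsGaussianProcess x P}
    (hx : IsSpectralCurve (processLp hg) ρ M) (hm : Measurable fun p : ℝ × Ω => x p.1 p.2)
    (h0 : ∀ t, ∫ ω, x t ω ∂P = 0) (hH : MemLp H 2 (volume : Measure ℝ)) (τ t : ℝ) :
    laggedProduct P H x τ t =ᵐ[P] productLp hx h0 hH τ t := by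
  filter_upwards [coeFn_productLp hx h0 hH τ t, response_ae_eq hx hm hH (t + τ),
    coeFn_processLp hg t] with ω h1 h2 h3
  rw [laggedProduct, h1, h2, h3]

theorem riemannSum_ae_eq {hg : IsGaussianProcess x P}
    (hx : IsSpectralCurve (processLp hg) ρ M) (hm : Measurable fun p : ℝ × Ω => x p.1 p.2)
    (h0 : ∀ t, ∫ ω, x t ω ∂P = 0) (hH : MemLp H 2 (volume : Measure ℝ)) (τ : ℝ) {a b : ℝ}
    (π : TaggedPart a b) :
    riemannSum (laggedProduct P H x τ) π =ᵐ[P]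
      (∑ k ∈ Finset.range π.n, (π.pts (k + 1) - π.pts k) • productLp hx h0 hH τ (π.tag k) :
        Lp ℝ 2 P) := by
  have h1 : ∀ k, ((π.pts (k + 1) - π.pts k) • productLp hx h0 hH τ (π.tag k) : Lp ℝ 2 P) =ᵐ[P]
      fun ω => laggedProduct P H x τ (π.tag k) ω * (π.pts (k + 1) - π.pts k) := by
    intro k
    filter_upwards [Lp.coeFn_smul (π.pts (k + 1) - π.pts k) (productLp hx h0 hH τ (π.tag k)),
      laggedProduct_ae_eq hx hm h0 hH τ (π.tag k)] with ω e1 e2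
    rw [e1, Pi.smul_apply, e2, smul_eq_mul, mul_comm]
  refine Filter.EventuallyEq.trans ?_ (Lp.coeFn_fun_finsetSum _ _).symm
  filter_upwards [ae_all_iff.2 h1] with ω hω
  exact Finset.sum_congr rfl fun k _ => (hω k).symm

theorem isMSLimit_integral_productLp {hg : IsGaussianProcess x P}
    (hx : IsSpectralCurve (processLp hg) ρ M) (hm : Measurable fun p : ℝ × Ω => x p.1 p.2)
    (h0 : ∀ t, ∫ ω, x t ω ∂P = 0) (hH : MemLp H 2 (volume : Measure ℝ)) (τ : ℝ) {T : ℝ}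
    (hT : 0 ≤ T) :
    IsMSLimit P (TaggedPart.fine 0 T) (riemannSum (laggedProduct P H x τ))
      (∫ t in Ioc 0 T, productLp hx h0 hH τ t : Lp ℝ 2 P) := by
  rw [← intervalIntegral.integral_of_le hT]
  exact isMSLimit_of_tendsto_Lp (Eventually.of_forall (riemannSum_ae_eq hx hm h0 hH τ))
    (TaggedPart.tendsto_sum_smul hT (continuous_productLp hx h0 hH τ))

theorem msRiemannIntegral_ae_eq {hg : IsGaussianProcess x P}
    (hx : IsSpectralCurve (processLp hg) ρ M) (hm : Measurable fun p : ℝ × Ω => x p.1 p.2)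
    (h0 : ∀ t, ∫ ω, x t ω ∂P = 0) (hH : MemLp H 2 (volume : Measure ℝ)) (τ : ℝ) {T : ℝ}
    (hT : 0 ≤ T) :
    msRiemannIntegral P (laggedProduct P H x τ) 0 T =ᵐ[P]
      (∫ t in Ioc 0 T, productLp hx h0 hH τ t : Lp ℝ 2 P) := by
  have h := isMSLimit_integral_productLp hx hm h0 hH τ hT
  have := TaggedPart.fine_neBot hT
  exact IsMSLimit.ae_eq (Eventually.of_forall fun π =>
    (Lp.aestronglyMeasurable _).congr (riemannSum_ae_eq hx hm h0 hH τ π).symm)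
    h.isMSLimit_msLimit h

/-! ### Covariances of the correlogram -/

/-- Isserlis' formula: the pairing within each lagged product gives the product of means, and the
other two pairings form `productCov`. -/
theorem inner_productLp {hg : IsGaussianProcess x P}
    (hx : IsSpectralCurve (processLp hg) ρ M) (h0 : ∀ t, ∫ ω, x t ω ∂P = 0)
    (hH : MemLp H 2 (volume : Measure ℝ)) (τ₁ τ₂ t s : ℝ) :
    inner ℝ (productLp hx h0 hH τ₁ t) (productLp hx h0 hH τ₂ s) =
      (∫ ω, productLp hx h0 hH τ₁ t ω ∂P) * (∫ ω, productLp hx h0 hH τ₂ s ω ∂P) +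
        productCov hx hH τ₁ τ₂ (t, s) := by
  have hE : ∀ τ t, ∫ ω, productLp hx h0 hH τ t ω ∂P =
      inner ℝ (responseLp hx hH (t + τ)) (processLp hg t) := by
    intro τ t
    rw [L2.inner_def, integral_congr_ae (coeFn_productLp hx h0 hH τ t)]
    refine integral_congr_ae (Eventually.of_forall fun ω => ?_)
    dsimp only
    rw [RCLike.inner_apply, conj_trivial, mul_comm]
  have hI := (hasGaussianMoments_gaussianSpan hg h0).integral_mul_mul_mul
    (responseLp_mem hx hH (t + τ₁)) (processLp_mem hg t) (responseLp_mem hx hH (s + τ₂))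
    (processLp_mem hg s)
  rw [hE, hE, productCov, ← add_assoc, ← hI, L2.inner_def]
  apply integral_congr_ae
  filter_upwards [coeFn_productLp hx h0 hH τ₁ t, coeFn_productLp hx h0 hH τ₂ s] with ω h1 h2
  rw [h1, h2, RCLike.inner_apply, conj_trivial]
  ring

/-- Expectation becomes a continuous linear functional on `L²`, which commutes with Bochner
integrals. -/
theorem integral_eq_inner_one (ξ : Lp ℝ 2 P) :
    ∫ ω, ξ ω ∂P = inner ℝ (indicatorConstLp 2 MeasurableSet.univ (measure_ne_top P univ) (1 : ℝ))
      ξ := by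
  rw [L2.inner_indicatorConstLp_one, Measure.restrict_univ]

theorem inner_integral_productLp_sub {hg : IsGaussianProcess x P}
    (hx : IsSpectralCurve (processLp hg) ρ M) (h0 : ∀ t, ∫ ω, x t ω ∂P = 0)
    (hH : MemLp H 2 (volume : Measure ℝ)) (τ₁ τ₂ T : ℝ) :
    inner ℝ (∫ t in Ioc 0 T, productLp hx h0 hH τ₁ t) (∫ t in Ioc 0 T, productLp hx h0 hH τ₂ t) -
      (∫ ω, (∫ t in Ioc 0 T, productLp hx h0 hH τ₁ t : Lp ℝ 2 P) ω ∂P) *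
        (∫ ω, (∫ t in Ioc 0 T, productLp hx h0 hH τ₂ t : Lp ℝ 2 P) ω ∂P) =
      ∫ z, productCov hx hH τ₁ τ₂ z ∂(squareMeasure T) := by
  have hc := continuous_productLp hx h0 hH
  have hE : ∀ τ, ∫ ω, (∫ t in Ioc 0 T, productLp hx h0 hH τ t : Lp ℝ 2 P) ω ∂P =
      ∫ t in Ioc 0 T, ∫ ω, productLp hx h0 hH τ t ω ∂P := by
    intro τ
    simp only [integral_eq_inner_one]
    rw [integral_inner]
    exact ((hc τ).continuousOn.integrableOn_compact isCompact_Icc).mono_set Ioc_subset_Icc_self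
  have hEc : ∀ τ, Continuous fun t => ∫ ω, productLp hx h0 hH τ t ω ∂P := by
    intro τ
    simp only [integral_eq_inner_one]
    have := hc τ
    fun_prop
  have hprod : Continuous fun z : ℝ × ℝ => (∫ ω, productLp hx h0 hH τ₁ z.1 ω ∂P) *
      ∫ ω, productLp hx h0 hH τ₂ z.2 ω ∂P :=
    ((hEc τ₁).comp continuous_fst).mul ((hEc τ₂).comp continuous_snd)
  rw [inner_integral_integral (hc τ₁) (hc τ₂), hE, hE, ← integral_prod_mul, ← integral_sub
    (Continuous.integrable_square (by have := hc τ₁; have := hc τ₂; fun_prop) T)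
    (hprod.integrable_square T)]
  refine integral_congr_ae (Eventually.of_forall fun z => ?_)
  dsimp only
  rw [inner_productLp, add_sub_cancel_left]

theorem integral_centredError_mul {hg : IsGaussianProcess x P}
    (hx : IsSpectralCurve (processLp hg) ρ M) (hm : Measurable fun p : ℝ × Ω => x p.1 p.2)
    (h0 : ∀ t, ∫ ω, x t ω ∂P = 0) (hH : MemLp H 2 (volume : Measure ℝ)) {c T : ℝ} (hc : c ≠ 0)
    (hT : 0 < T) (τ₁ τ₂ : ℝ) :
    ∫ ω, centredError P c H x T τ₁ ω * centredError P c H x T τ₂ ω ∂P =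
      1 / c ^ 2 * (1 / T * ∫ z, productCov hx hH τ₁ τ₂ z ∂(squareMeasure T)) := by
  set J : ℝ → Lp ℝ 2 P := fun τ => ∫ t in Ioc 0 T, productLp hx h0 hH τ t with hJ
  have hae : ∀ τ, centredError P c H x T τ =ᵐ[P]
      fun ω => Real.sqrt T * (1 / (c * T)) * (J τ ω - ∫ ω', J τ ω' ∂P) := by
    intro τ
    have h1 := msRiemannIntegral_ae_eq hx hm h0 hH τ hT.le
    have h2 : ∫ ω', correlogram P c H x T τ ω' ∂P = 1 / (c * T) * ∫ ω', J τ ω' ∂P := by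
      simp only [correlogram]
      rw [integral_const_mul, integral_congr_ae h1]
    filter_upwards [h1] with ω hω
    rw [centredError, h2, correlogram, hω]
    ring
  have hcov : ∫ ω, (J τ₁ ω - ∫ ω', J τ₁ ω' ∂P) * (J τ₂ ω - ∫ ω', J τ₂ ω' ∂P) ∂P =
      inner ℝ (J τ₁) (J τ₂) - (∫ ω, J τ₁ ω ∂P) * (∫ ω, J τ₂ ω ∂P) := by
    have hin : inner ℝ (J τ₁) (J τ₂) = ∫ ω, J τ₁ ω * J τ₂ ω ∂P := by
      rw [L2.inner_def]
      refine integral_congr_ae (Eventually.of_forall fun ω => ?_)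
      dsimp only
      rw [RCLike.inner_apply, conj_trivial, mul_comm]
    have hcv := covariance_eq_sub (Lp.memLp (J τ₁)) (Lp.memLp (J τ₂))
    rw [hin]
    exact hcv
  have hmul : ∫ ω, centredError P c H x T τ₁ ω * centredError P c H x T τ₂ ω ∂P =
      ∫ ω, (Real.sqrt T * (1 / (c * T))) ^ 2 *
        ((J τ₁ ω - ∫ ω', J τ₁ ω' ∂P) * (J τ₂ ω - ∫ ω', J τ₂ ω' ∂P)) ∂P := by
    apply integral_congr_ae
    filter_upwards [hae τ₁, hae τ₂] with ω h1 h2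
    rw [h1, h2]
    ring
  rw [hmul, integral_const_mul, hcov, inner_integral_productLp_sub, mul_pow, Real.sq_sqrt hT.le]
  have := hT.ne'
  field_simp

end GaussianResponse

/-! ### The limit of the covariances -/

theorem fourierChar_mul_div_two_pi (l w : ℝ) :
    (𝐞 (l / (2 * Real.pi) * w) : ℂ) = Complex.exp (Complex.I * w * l) := by
  rw [Real.fourierChar_apply]
  congr 1
  have := Real.pi_ne_zero
  push_cast
  field_simp

/-- The substitution `λ = 2πν` turns the density `f` into `2π f(2πν)`, and the limiting height `c /
2π` into `c`. -/
theorem fourierInv_two_pi_mul_comp (f : ℝ → ℝ) (w : ℝ) :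
    𝓕⁻ (fun ν => ((2 * Real.pi * f (2 * Real.pi * ν) : ℝ) : ℂ)) w =
      ∫ l : ℝ, Complex.exp (Complex.I * l * w) * (f l : ℂ) := by
  have hpi : (0 : ℝ) < 2 * Real.pi := Real.two_pi_pos
  have h := Measure.integral_comp_mul_left
    (fun l : ℝ => (2 * Real.pi : ℂ) * (Complex.exp (Complex.I * l * w) * (f l : ℂ))) (2 * Real.pi)
  rw [abs_of_pos (inv_pos.2 hpi), integral_const_mul, integral_const_mul,
    Complex.real_smul, ← mul_assoc] at h
  have hpc : ((2 * Real.pi)⁻¹ : ℝ) * (2 * Real.pi : ℂ) = 1 := by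
    push_cast
    exact inv_mul_cancel₀ (mul_ne_zero two_ne_zero (Complex.ofReal_ne_zero.2 Real.pi_ne_zero))
  rw [hpc, one_mul] at h
  rw [← h, ← integral_const_mul, fourierInv_real_eq_integral]
  refine integral_congr_ae (Eventually.of_forall fun ν => ?_)
  dsimp only
  have e := fourierChar_mul_div_two_pi (2 * Real.pi * ν) w
  rw [mul_div_cancel_left₀ ν hpi.ne'] at e
  rw [e]
  push_cast
  ring_nf

theorem limitCov_eq (H : ℝ → ℝ) (hH : MemLp H 2 (volume : Measure ℝ)) (τ₁ τ₂ : ℝ) :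
    limitCov H hH τ₁ τ₂ =
      (∫ ν, (𝐞 (ν * (τ₁ - τ₂)) : ℂ) *
        (‖(𝓕 hH.complex_ofReal.toLp : Lp ℂ 2 (volume : Measure ℝ)) ν‖ : ℂ) ^ 2) +
      ∫ ν, (𝐞 (ν * (τ₁ + τ₂)) : ℂ) *
        (𝓕 hH.complex_ofReal.toLp : Lp ℂ 2 (volume : Measure ℝ)) ν ^ 2 := by
  set G : Lp ℂ 2 (volume : Measure ℝ) := 𝓕 hH.complex_ofReal.toLp with hG
  have hpi : (0 : ℝ) < 2 * Real.pi := Real.two_pi_pos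
  have hchar : ∀ τ : ℝ, AEStronglyMeasurable (fun ν : ℝ => (𝐞 (ν * τ) : ℂ)) volume := fun τ =>
    Continuous.aestronglyMeasurable (by fun_prop)
  have h2 : Integrable fun ν => ((‖G ν‖ ^ 2 : ℝ) : ℂ) :=
    ((Lp.memLp G).integrable_norm_pow (by norm_num)).complex_ofReal
  push_cast at h2
  have h2' : Integrable fun ν => G ν ^ 2 := by
    simp only [pow_two]
    exact (Lp.memLp G).integrable_mul (Lp.memLp G)
  have i1 := h2.bdd_mul (c := 1) (hchar (τ₁ - τ₂))
    (Eventually.of_forall fun ν => (Circle.norm_coe _).le)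
  have i2 := h2'.bdd_mul (c := 1) (hchar (τ₁ + τ₂))
    (Eventually.of_forall fun ν => (Circle.norm_coe _).le)
  rw [← integral_add i1 i2, limitCov]
  have h := Measure.integral_comp_div (fun ν => (𝐞 (ν * (τ₁ - τ₂)) : ℂ) * (‖G ν‖ : ℂ) ^ 2 +
    (𝐞 (ν * (τ₁ + τ₂)) : ℂ) * G ν ^ 2) (2 * Real.pi)
  rw [abs_of_pos hpi, Complex.real_smul] at h
  have e : ∫ l : ℝ, (Complex.exp (Complex.I * (τ₁ - τ₂) * l) *
      (‖fourierPlancherel H hH l‖ : ℂ) ^ 2 +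
        Complex.exp (Complex.I * (τ₁ + τ₂) * l) * fourierPlancherel H hH l ^ 2) =
      ((2 * Real.pi : ℝ) : ℂ) * ∫ ν, ((𝐞 (ν * (τ₁ - τ₂)) : ℂ) * (‖G ν‖ : ℂ) ^ 2 +
        (𝐞 (ν * (τ₁ + τ₂)) : ℂ) * G ν ^ 2) := by
    rw [← h]
    refine integral_congr_ae (Eventually.of_forall fun l => ?_)
    dsimp only
    rw [fourierChar_mul_div_two_pi, fourierChar_mul_div_two_pi]
    push_cast
    rfl
  rw [e, ← mul_assoc]
  have hpc : (1 / (2 * Real.pi : ℂ)) * ((2 * Real.pi : ℝ) : ℂ) = 1 := by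
    push_cast
    exact one_div_mul_cancel (mul_ne_zero two_ne_zero (Complex.ofReal_ne_zero.2 Real.pi_ne_zero))
  rw [hpc, one_mul]

theorem IsInputFamily.isSpectralCurve {Ω : Type*} [MeasurableSpace Ω] {P : Measure Ω}
    {X : ℝ → ℝ → Ω → ℝ} {f : ℝ → ℝ → ℝ} {c M : ℝ} (hX : IsInputFamily P X f c)
    (hM : ∀ Δ > 0, ∀ l, f Δ l ≤ M) {Δ : ℝ} (hΔ : 0 < Δ) :
    IsSpectralCurve (processLp (hX.gaussian Δ hΔ)) (fun ν => 2 * Real.pi * f Δ (2 * Real.pi * ν))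
      (2 * Real.pi * M) where
  inner_eq s t := by
    rw [inner_processLp, fourierInv_two_pi_mul_comp]
    have := hX.spectral Δ hΔ t (s - t)
    rw [add_sub_cancel] at this
    exact this
  continuous_density := by
    have := hX.density_continuous Δ hΔ
    fun_prop
  density_nonneg ν := mul_nonneg Real.two_pi_pos.le (hX.density_nonneg Δ hΔ _)
  density_le ν := mul_le_mul_of_nonneg_left (hM Δ hΔ _) Real.two_pi_pos.le
  integrable_density :=
    ((hX.density_integrable Δ hΔ).comp_mul_left' Real.two_pi_pos.ne').const_mul _

/-- The densities are controlled only for `Δ > 0`, while `IsFlatteningFamily` quantifies over all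
real parameters; reparametrizing by a positive `D` bridges the gap. -/
theorem IsInputFamily.isFlatteningFamily {Ω : Type*} [MeasurableSpace Ω] {P : Measure Ω}
    {X : ℝ → ℝ → Ω → ℝ} {f : ℝ → ℝ → ℝ} {c M : ℝ} (hX : IsInputFamily P X f c)
    (hM : ∀ Δ > 0, ∀ l, f Δ l ≤ M) {D : ℝ → ℝ} (hD : ∀ Δ, 0 < D Δ) (hD' : Tendsto D atTop atTop) :
    IsFlatteningFamily (fun Δ ν => 2 * Real.pi * f (D Δ) (2 * Real.pi * ν)) c
      (2 * Real.pi * M) where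
  continuous Δ := (hX.isSpectralCurve hM (hD Δ)).continuous_density
  nonneg Δ := (hX.isSpectralCurve hM (hD Δ)).density_nonneg
  le Δ := (hX.isSpectralCurve hM (hD Δ)).density_le
  integrable Δ := (hX.isSpectralCurve hM (hD Δ)).integrable_density
  tendsto a ha := by
    have hpi : (0 : ℝ) < 2 * Real.pi := Real.two_pi_pos
    rw [Metric.tendstoUniformlyOn_iff]
    intro ε hε
    have h := hD'.eventually (Metric.tendstoUniformlyOn_iff.1
      (hX.density_tendsto (2 * Real.pi * a) (by positivity)) (ε / (2 * Real.pi)) (by positivity))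
    filter_upwards [h] with Δ hΔ ν hν
    have := hΔ (2 * Real.pi * ν) ⟨by nlinarith [hν.1], by nlinarith [hν.2]⟩
    rw [Real.dist_eq, lt_div_iff₀ hpi] at this
    rw [Real.dist_eq]
    calc |c - 2 * Real.pi * f (D Δ) (2 * Real.pi * ν)|
        = |c / (2 * Real.pi) - f (D Δ) (2 * Real.pi * ν)| * (2 * Real.pi) := by
          rw [← abs_of_pos hpi, ← abs_mul, abs_of_pos hpi, sub_mul, div_mul_cancel₀ _ hpi.ne',
            mul_comm (f _ _)]
      _ < ε := this

theorem IsInputFamily.tendsto_covariance {Ω : Type*} [MeasurableSpace Ω] {P : Measure Ω}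
    [IsProbabilityMeasure P] {X : ℝ → ℝ → Ω → ℝ} {f : ℝ → ℝ → ℝ} {c : ℝ}
    (hX : IsInputFamily P X f c) {H : ℝ → ℝ} (hH : MemLp H 2 (volume : Measure ℝ)) (τ₁ τ₂ : ℝ) :
    Tendsto (fun q : ℝ × ℝ =>
        ((∫ ω, centredError P c H (X q.2) q.1 τ₁ ω * centredError P c H (X q.2) q.1 τ₂ ω ∂P : ℝ)
          : ℂ))
      (atTop ×ˢ atTop) (𝓝 (limitCov H hH τ₁ τ₂)) := by
  obtain ⟨M, hM⟩ := hX.density_bounded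
  have hc : (c : ℂ) ≠ 0 := by exact_mod_cast hX.const_pos.ne'
  -- The parameter `max Δ 1` is always positive and equals `Δ` once `Δ ≥ 1`.
  have hD : ∀ Δ : ℝ, 0 < max Δ 1 := fun Δ => lt_max_of_lt_right one_pos
  have hρ := hX.isFlatteningFamily hM hD (tendsto_atTop_mono (fun Δ => le_max_left Δ 1) tendsto_id)
  have h := ((hρ.tendsto_auto (𝓕 hH.complex_ofReal.toLp) (τ₁ - τ₂)).add
    (hρ.tendsto_cross (𝓕 hH.complex_ofReal.toLp) τ₁ τ₂)).const_mul (1 / (c : ℂ) ^ 2)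
  rw [← mul_add, ← limitCov_eq, ← mul_assoc, one_div_mul_cancel (pow_ne_zero 2 hc), one_mul] at h
  refine h.congr' ?_
  filter_upwards [(eventually_gt_atTop (0 : ℝ)).prod_mk (eventually_ge_atTop (1 : ℝ))] with q hq
  have hq2 : 0 < q.2 := zero_lt_one.trans_le hq.2
  have hx := hX.isSpectralCurve hM hq2
  rw [integral_centredError_mul hx (hX.measurable q.2 hq2) (hX.centred q.2 hq2) hH
    hX.const_pos.ne' hq.1, max_eq_left hq.2, Complex.ofReal_mul, Complex.ofReal_mul,
    ← integral_complex_ofReal]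
  simp only [productCov_eq]
  have hR : Continuous (𝓕⁻ (fun ν => ((2 * Real.pi * f q.2 (2 * Real.pi * ν) : ℝ) : ℂ) *
      (𝓕 hH.complex_ofReal.toLp : Lp ℂ 2 (volume : Measure ℝ)) ν)) :=
    continuous_fourierInv (hx.memLp_two.integrable_mul (Lp.memLp _))
  have hcross : Continuous fun z : ℝ × ℝ =>
      𝓕⁻ (fun ν => ((2 * Real.pi * f q.2 (2 * Real.pi * ν) : ℝ) : ℂ) *
        (𝓕 hH.complex_ofReal.toLp : Lp ℂ 2 (volume : Measure ℝ)) ν) (z.1 - z.2 + τ₁) *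
      𝓕⁻ (fun ν => ((2 * Real.pi * f q.2 (2 * Real.pi * ν) : ℝ) : ℂ) *
        (𝓕 hH.complex_ofReal.toLp : Lp ℂ 2 (volume : Measure ℝ)) ν) (z.2 - z.1 + τ₂) := by
    fun_prop
  have hsum : Continuous fun z => (productCov hx hH τ₁ τ₂ z : ℂ) :=
    Complex.continuous_ofReal.comp (continuous_productCov hx hH τ₁ τ₂)
  -- Continuity of the auto-covariance term is obtained by subtracting the cross term from the
  -- continuous `productCov`.
  have hauto := hsum.sub hcross
  simp only [productCov_eq, Pi.sub_def, add_sub_cancel_right] at hauto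
  rw [integral_add (hauto.integrable_square q.1) (hcross.integrable_square q.1), mul_add,
    mul_add, mul_add]
  push_cast
  ring

theorem mainTheorem8 {Ω : Type*} [MeasurableSpace Ω] (P : Measure Ω) [IsProbabilityMeasure P]
    (X : ℝ → ℝ → Ω → ℝ) (f : ℝ → ℝ → ℝ) (c : ℝ) (hX : IsInputFamily P X f c)
    (H : ℝ → ℝ) (hH : MemLp H 2 (volume : Measure ℝ)) :
    -- the mean-square limits that define the output and the estimator exist
    (∀ Δ > 0, ∀ t : ℝ, IsMSLimit P (atBot ×ˢ atTop) (truncatedResponse H (X Δ) t)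
      (response P H (X Δ) t)) ∧
    (∀ T > 0, ∀ Δ > 0, ∀ τ : ℝ, IsMSLimit P (TaggedPart.fine 0 T)
      (riemannSum (laggedProduct P H (X Δ) τ))
      (msRiemannIntegral P (laggedProduct P H (X Δ) τ) 0 T)) ∧
    -- convergence of the covariances as `(T, Δ) → ∞`
    ∀ τ₁ τ₂ : ℝ,
      Tendsto (fun q : ℝ × ℝ =>
          ((∫ ω, centredError P c H (X q.2) q.1 τ₁ ω * centredError P c H (X q.2) q.1 τ₂ ω ∂P : ℝ)
            : ℂ))
        (atTop ×ˢ atTop) (𝓝 (limitCov H hH τ₁ τ₂)) := by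
  obtain ⟨M, hM⟩ := hX.density_bounded
  refine ⟨fun Δ hΔ t => ?_, fun T hT Δ hΔ τ => ?_, hX.tendsto_covariance hH⟩
  · exact (isMSLimit_responseLp (hX.isSpectralCurve hM hΔ) (hX.measurable Δ hΔ) hH
      t).isMSLimit_msLimit
  · exact (isMSLimit_integral_productLp (hX.isSpectralCurve hM hΔ) (hX.measurable Δ hΔ)
      (hX.centred Δ hΔ) hH τ (le_of_lt hT)).isMSLimit_msLimit
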